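/- **Model.** Let $T$ be a finite tree with root $r$. The edges at every vertex $v$ carry distinct labels (ports) $0,\dots,\delta_v-1$, where $\delta_v$ is the degree of $v$, and at every $v\ne r$ the edge towards $r$ has label $0$. Let $d(v)$ be the depth of $v$ and $T(v)$ the subtree of all vertices whose path to $r$ contains $v$. There are $k$ agents at $r$, each of which can traverse at most $B$ edges; they communicate globally. A vertex is *explored* once an agent has visited it; $r$ is explored at the start. For a subtree $S$ let $r_S$ be its vertex of least depth. Let $\mathrm{OPT}(T,r,k,B)$ be the maximum number of distinct vertices visited by $k$ walks in $T$ that start at $r$ and have at most $B$ edges each. **Searches.** The L-DFS (R-DFS) sequence of a subtree $S$ is the sequence of directed edges traversed by a depth-first search of $S$ from $r_S$ that visits the children of every vertex in increasing (decreasing) order of their ports. The leftmost (rightmost) unexplored vertex of $S$ is the head of the first edge of this sequence that leads to an unexplored vertex. The call L-DFS$(S,u)$ takes a new agent from $r$ and moves it on the shortest path to $u$. Then, as long as the agent has energy left and $S$ is not completely explored, it does the following: if all vertices of $S$ below its current vertex are explored, it traverses the edge with label $0$; otherwise it traverses the edge with the smallest port to a child below which (the child included) $S$ has an unexplored vertex.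 An agent without energy stops. The call R-DFS$(S,u)$ is the same with the largest port. **Divide & Explore.** Start with $\mathcal T=\{T\}$, call L-DFS$(T,r)$ and then, if $k\ge 2$, R-DFS$(T,r)$. While $T$ has an unexplored vertex and there is an unused agent, repeat: 1. For every $S\in\mathcal T$ with an unexplored vertex: as long as $r_S$ has exactly one child $v$ in $S$ such that $T(v)$ contains an unexplored vertex, and this $v$ is explored, replace $S$ by $T(v)$. 2. Let $S\in\mathcal T$ be a subtree with an unexplored vertex that minimizes $d(r_S)$ (ties are broken arbitrarily), and let $v_L$, $v_R$ be its leftmost and rightmost unexplored vertices. * If $d(v_L)-d(r_S)\le\max\{1,\tfrac13(B-d(r_S))\}$, call L-DFS$(S,v_L)$. * Otherwise, if $d(v_R)-d(r_S)\le\max\{1,\tfrac13(B-d(r_S))\}$, call R-DFS$(S,v_R)$. * Otherwise let $v$ be the child of $r_S$ with $v_R\in T(v)$, let $S^{(1)}$ be the subtree of $S$ on the vertices not in $T(v)$ and $S^{(2)}$ the subtree of $S$ on $r_S$ and the vertices in $T(v)$. Replace $S$ in $\mathcal T$ by $S^{(1)}$ and $S^{(2)}$, call R-DFS$(S^{(1)},r_S)$,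 and then, if an unused agent is left, L-DFS$(S^{(2)},r_S)$. **Theorem.** Divide & Explore is 3-competitive: for every instance $(T,r,k,B)$ and every way of breaking ties, the number $\mathrm{ALG}(T,r,k,B)$ of distinct vertices visited by the agents that follow Divide & Explore satisfies $$\mathrm{OPT}(T,r,k,B)\le 3\cdot\mathrm{ALG}(T,r,k,B).$$ -/

import Mathlib

/-- A finite undirected tree with a root and local port numbers: the edges at every vertex `v` carry
the labels `0, …, δ_v - 1`, and at every `v ≠ root` the edge towards the root has label `0`. -/
structure PortTree (V : Type*) [Fintype V] where
  graph : SimpleGraph V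
  isTree : graph.IsTree
  root : V
  /-- `nbr v p` is the other end of the edge with port number `p` at `v`
  (relevant only for `p < δ_v`). -/
  nbr : V → ℕ → V
  nbr_bijOn : ∀ v, Set.BijOn (nbr v) (Set.Iio (graph.neighborSet v).ncard) (graph.neighborSet v)
  nbr_zero : ∀ v, v ≠ root → graph.dist root (nbr v 0) < graph.dist root v

/-- A subtree, given by its vertex set together with its root (its vertex of least depth). -/
structure Subtree (V : Type*) where
  root : V
  verts : Set V

/-- The two kinds of depth-first search: L-DFS and R-DFS. -/
inductive Dir where
  | left : Dir
  | right : Dir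

namespace PortTree

noncomputable section

variable {V : Type*} [Fintype V] (T : PortTree V)

/-- The degree `δ_v`. -/
def deg (v : V) : ℕ := (T.graph.neighborSet v).ncard

/-- The depth `d(v)`. -/
def depth (v : V) : ℕ := T.graph.dist T.root v

/-- The vertex set of `T(v)`: all `w` such that `v` lies on the path from the root to `w`. -/
def below (v : V) : Set V := {w | T.depth w = T.depth v + T.graph.dist v w}

/-- The whole tree as a subtree of itself. -/
def whole : Subtree V := ⟨T.root, Set.univ⟩

/-- The ports at `v` that lead to children of `v` (all ports at the root, and the ports `l > 0` at
every other vertex), in the order in which an L-DFS, respectively an R-DFS, considers them. -/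
def childPorts (dir : Dir) (v : V) : List ℕ :=
  open Classical in
  let l := (List.range (T.deg v)).filter fun p => decide (v = T.root ∨ 0 < p)
  match dir with
  | .left => l
  | .right => l.reverse

/-- The ports at `v` to those children below which `S` is not completely explored, where `X` is the
set of explored vertices. -/
def openPorts (dir : Dir) (S : Subtree V) (X : Set V) (v : V) : List ℕ :=
  open Classical in
  (T.childPorts dir v).filter fun p => decide (¬ (S.verts ∩ T.below (T.nbr v p) ⊆ X))

/-- The sequence of directed edges of an L-DFS (R-DFS) of the part of `S` below `v`. The number `n`
bounds the height up to which the search is unfolded. -/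
def dfsSeqAux (dir : Dir) (S : Subtree V) : ℕ → V → List (V × V)
  | 0, _ => []
  | n + 1, v =>
    open Classical in
    ((T.childPorts dir v).filter fun p => decide (T.nbr v p ∈ S.verts)).flatMap fun p =>
      (v, T.nbr v p) :: (dfsSeqAux dir S n (T.nbr v p) ++ [(T.nbr v p, v)])

/-- The L-DFS (R-DFS) sequence of `S`; no subtree has height more than the number of vertices. -/
def dfsSeq (dir : Dir) (S : Subtree V) : List (V × V) :=
  T.dfsSeqAux dir S (Fintype.card V) S.root

/-- The leftmost (rightmost) unexplored vertex of `S`: the head of the first edge of the L-DFS (R-DFS)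
sequence of `S` that leads to an unexplored vertex (with a default if there is none). -/
def extremeUnexplored (dir : Dir) (S : Subtree V) (X : Set V) : V :=
  open Classical in
  (((T.dfsSeq dir S).find? fun e => decide (e.2 ∉ X)).map Prod.snd).getD S.root

/-- The edge traversal that an agent at `v` performs in the search of `S`: if `S` is completely
explored below `v` it traverses the edge with label `0`, otherwise the first edge (in the order of
the search) to a child below which `S` is not completely explored. -/
def dfsMove (dir : Dir) (S : Subtree V) (X : Set V) (v : V) : V :=
  open Classical in
  if S.verts ∩ T.below v ⊆ X then T.nbr v 0
  else T.nbr v ((T.openPorts dir S X v).headD 0)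

/-- The search loop of an agent at `v` with a given remaining energy, when the vertices in `X` are
explored; the result is the set of explored vertices after the agent has stopped. -/
def dfsLoop (dir : Dir) (S : Subtree V) : ℕ → V → Set V → Set V
  | 0, _, X => X
  | e + 1, v, X =>
    open Classical in
    if S.verts ⊆ X then X
    else dfsLoop dir S e (T.dfsMove dir S X v) (insert (T.dfsMove dir S X v) X)

/-- The calls L-DFS`(S, u)` and R-DFS`(S, u)` for an agent at the root with energy `B`: it moves on
the shortest path to `u`, as far as its energy allows, and searches with its remaining energy (there
is none if `B ≤ d(u)`). The result is the set of explored vertices afterwards. -/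
def runAgent (B : ℕ) (dir : Dir) (S : Subtree V) (u : V) (X : Set V) : Set V :=
  T.dfsLoop dir S (B - T.depth u) u (X ∪ {w | u ∈ T.below w ∧ T.depth w ≤ B})

/-- The inner while-loop, with at most `n` iterations: as long as exactly one child `c` of the root of
the subtree leads to an unexplored vertex and there is no unexplored child (that is, `c` itself is
explored), the subtree is replaced by `T(c)`. -/
def moveDownAux (X : Set V) : ℕ → Subtree V → Subtree V
  | 0, S => S
  | n + 1, S =>
    open Classical in
    match T.openPorts .left S X S.root with
    | [p] =>
      if T.nbr S.root p ∈ X then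
        moveDownAux X n ⟨T.nbr S.root p, T.below (T.nbr S.root p)⟩
      else S
    | _ => S

/-- The inner while-loop; it stops after fewer iterations than there are vertices. -/
def moveDown (X : Set V) (S : Subtree V) : Subtree V :=
  T.moveDownAux X (Fintype.card V) S

/-- The subtrees in `F` that contain an unexplored vertex and, among these, have a root of least
depth. -/
def highest (F : Set (Subtree V)) (X : Set V) : Set (Subtree V) :=
  {S | S ∈ F ∧ ¬ S.verts ⊆ X ∧ ∀ S' ∈ F, ¬ S'.verts ⊆ X → T.depth S.root ≤ T.depth S'.root}

/-- The condition `d(v) - d(r_S) ≤ max {1, (B - d(r_S)) / 3}`. -/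
def Near (B : ℕ) (S : Subtree V) (v : V) : Prop :=
  (T.depth v : ℚ) - T.depth S.root ≤ max 1 (1 / 3 * ((B : ℚ) - T.depth S.root))

/-- The child of `u` leading to `w`. -/
def childToward (u w : V) : V :=
  open Classical in
  T.nbr u (((T.childPorts .left u).find? fun p => decide (w ∈ T.below (T.nbr u p))).getD 0)

/-- The induced subtree `S⁽¹⁾` of `S` on the vertices not in `T(v)`. -/
def splitFst (S : Subtree V) (v : V) : Subtree V := ⟨S.root, S.verts \ T.below v⟩

/-- The induced subtree `S⁽²⁾` of `S` on the vertices in `T(v)` and the root of `S`. -/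
def splitSnd (S : Subtree V) (v : V) : Subtree V := ⟨S.root, insert S.root (S.verts ∩ T.below v)⟩

/-- The outer while-loop. The first number is the number of unused agents at the root, `X` is the set
of explored vertices and `F` the current set of subtrees; the result is the final set of explored
vertices. Among the subtrees with a highest root, `tie` selects one; its first argument makes the
selection depend on the iteration. If the subtree is split when only one agent is left, the
algorithm ends after the first of the two searches. -/
def exploreLoop (B : ℕ) (tie : ℕ → Set (Subtree V) → Subtree V) :
    ℕ → Set V → Set (Subtree V) → Set V
  | 0, X, _ => X
  | k + 1, X, F =>
    open Classical in
    if X = Set.univ then X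
    else
      let F' := T.moveDown X '' F
      let S := tie k (T.highest F' X)
      let vL := T.extremeUnexplored .left S X
      let vR := T.extremeUnexplored .right S X
      if T.Near B S vL then exploreLoop B tie k (T.runAgent B .left S vL X) F'
      else if T.Near B S vR then exploreLoop B tie k (T.runAgent B .right S vR X) F'
      else
        let v := T.childToward S.root vR
        let S₁ := T.splitFst S v
        let S₂ := T.splitSnd S v
        let X₁ := T.runAgent B .right S₁ S.root X
        match k with
        | 0 => X₁
        | k' + 1 =>
          exploreLoop B tie k' (T.runAgent B .left S₂ S.root X₁) ((F' \ {S}) ∪ {S₁, S₂})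

/-- The set of vertices visited by `k` agents with energy `B` that follow Divide & Explore, where
ties between subtrees with equally high roots are broken by `tie`. -/
def divideAndExplore (B : ℕ) (tie : ℕ → Set (Subtree V) → Subtree V) : ℕ → Set V
  | 0 => ∅
  | 1 => T.runAgent B .left T.whole T.root {T.root}
  | k + 2 =>
    T.exploreLoop B tie k
      (T.runAgent B .right T.whole T.root (T.runAgent B .left T.whole T.root {T.root})) {T.whole}

/-- The numbers of distinct vertices that `k` agents can visit on walks from the root with at most `B`
edge traversals each. -/
def offlineValues (k B : ℕ) : Set ℕ :=
  {m | ∃ (e : Fin k → V) (W : ∀ i, T.graph.Walk T.root (e i)),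
    (∀ i, (W i).length ≤ B) ∧ {w | ∃ i, w ∈ (W i).support}.ncard = m}

/-- The offline optimum: the maximum number of distinct vertices that `k` agents can visit. -/
def opt (k B : ℕ) : ℕ := sSup (T.offlineValues k B)

/-- The maximum in the definition of `opt` exists. -/
theorem isGreatest_opt (k B : ℕ) : IsGreatest (T.offlineValues k B) (T.opt k B) := by
  have hb : BddAbove (T.offlineValues k B) := by
    refine ⟨Nat.card V, ?_⟩
    rintro m ⟨e, W, -, rfl⟩
    exact Set.ncard_le_card _
  have hn : (T.offlineValues k B).Nonempty :=
    ⟨_, fun _ => T.root, fun _ => .nil, fun _ => by simp, rfl⟩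
  exact ⟨Nat.sSup_mem hn hb, fun m hm => le_csSup hb hm⟩

end

end PortTree

namespace PortTree

variable {V : Type*} [Fintype V] (T : PortTree V)

/-! ### The rooted tree: depth, parents, children and descendants -/

/-! The proof is an amortized count with a budget of 3 per explored vertex. Fix a depth `D ≤ B`.
Explored vertices get gains `g v` in `[0, 1]`, unexplored vertices get gain 1, in such a way that a
walk of length at most `B` from the root collects at most `B - D`. If `k` walks visit a set `U`,
write each vertex of `U` as gain plus one minus gain: the gains sum to at most `k (B - D)`, and the
rest is at most the sum of `1 - g v` over the explored set `X`. It therefore suffices that the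
weights `2 + g v` of the explored vertices sum to at least `k (B - D)`, because `(2 + g v) + (1 - g
v) = 3`. This is `opt_le_of_isGain`.

A vertex explored by a search of a subtree with root depth `r` receives the gain `(B - D) / (B -
r)`, see `rate`; the ancestors of the roots of unfinished subtrees are reset to gain 0 down to depth
`D`. A walk has at most `B + 1` vertices. If it reaches an unexplored vertex, then it contains `D +
1` vertices of gain 0. Otherwise, if its largest gain is positive and was assigned with root depth
`r`, then it contains `r + 1` vertices of gain 0 and at most `B - r` others. In the end `D` is the
least root depth of an unfinished subtree. This is not known in advance, so `Invariant` keeps an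
account for every `D` that is at least the current least root depth.

An unfinished subtree holds the potential `B - min(d(r_S), D) + 3/2 * spread`, where the spread is
the total distance of the left and the right search position from its root. Lowering the root
releases enough potential to pay for the gains that are reset to 0 (`Account.replace`). The length
of a search is converted into explored vertices by `dfsLoop_spec`: moves that go down without
exploring anything force the root of the subtree down later, which shortens both distances
(`SearchState.moveDown`). A search that starts within a third of the remaining energy pays `B - D`
and the change of the spread (`search_inequality`, `near_search`). A search that starts at the root
of the subtree has a surplus of `(B - d(r_S)) / 2` (`root_search_inequality`, `root_search`). Two
such surpluses finance the additional subtree of a split (`Invariant.split`) and, at the beginning,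
the potential of the whole tree (`invariant_start`). -/

theorem depth_root : T.depth T.root = 0 := by simp [depth]

variable {T} in
theorem depth_pos {v : V} (hv : v ≠ T.root) : 0 < T.depth v :=
  T.isTree.connected.pos_dist_of_ne hv.symm

theorem adj_nbr {v : V} {p : ℕ} (hp : p < T.deg v) : T.graph.Adj v (T.nbr v p) :=
  (T.nbr_bijOn v).mapsTo hp

theorem deg_pos {v u : V} (h : T.graph.Adj v u) : 0 < T.deg v :=
  (Set.ncard_pos (Set.toFinite _)).2 ⟨u, h⟩

theorem adj_parent {v : V} (hv : v ≠ T.root) : T.graph.Adj v (T.nbr v 0) := by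
  refine T.adj_nbr ?_
  have hn : Nontrivial V := ⟨v, T.root, hv⟩
  obtain ⟨u, hu⟩ := T.isTree.connected.preconnected.exists_adj_of_nontrivial v
  exact T.deg_pos hu

theorem depth_adj {u v : V} (h : T.graph.Adj u v) :
    T.depth u = T.depth v + 1 ∨ T.depth v = T.depth u + 1 :=
  T.isTree.dist_eq_dist_add_one_of_adj T.root h

theorem depth_parent {v : V} (hv : v ≠ T.root) : T.depth (T.nbr v 0) + 1 = T.depth v := by
  have h1 := T.depth_adj (T.adj_parent hv)
  have h2 : T.depth (T.nbr v 0) < T.depth v := T.nbr_zero v hv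
  lia

/-- A shortest path from the root to a neighbour of smaller depth extends to a path to `v`. In a
tree there is only one path to `v`, and its penultimate vertex is this neighbour. -/
theorem eq_parent {v u : V} (h : T.graph.Adj v u) (hd : T.depth u < T.depth v) :
    u = T.nbr v 0 := by
  have hv : v ≠ T.root := by
    rintro rfl
    simp [depth_root] at hd
  have key : ∀ x, T.graph.Adj v x → T.depth x < T.depth v →
      ∀ p : T.graph.Walk T.root v, p.IsPath → x = p.penultimate := by
    intro x hx hxd p hp
    obtain ⟨q, hq⟩ := T.isTree.connected.exists_walk_length_eq_dist T.root x
    have hlen : (q.concat hx.symm).length = T.graph.dist T.root v := by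
      have h1 := T.depth_adj hx
      simp only [SimpleGraph.Walk.length_concat, hq]
      unfold depth at *
      lia
    have hpath := (q.concat hx.symm).isPath_of_length_eq_dist hlen
    have := (T.isTree.isAcyclic.subsingleton_path _ _).elim ⟨p, hp⟩ ⟨_, hpath⟩
    have h2 : p = q.concat hx.symm := congrArg Subtype.val this
    rw [h2, SimpleGraph.Walk.penultimate_concat]
  obtain ⟨p, hp, -⟩ := T.isTree.connected.exists_path_of_dist T.root v
  rw [key u h hd p hp, ← key _ (T.adj_parent hv) (T.nbr_zero v hv) p hp]

theorem mem_childPorts {dir : Dir} {v : V} {p : ℕ} :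
    p ∈ T.childPorts dir v ↔ p < T.deg v ∧ (v = T.root ∨ 0 < p) := by
  cases dir <;> simp [childPorts]

theorem child_ne_parent {dir : Dir} {v : V} {p : ℕ} (hp : p ∈ T.childPorts dir v)
    (hv : v ≠ T.root) : T.nbr v p ≠ T.nbr v 0 := by
  rw [mem_childPorts] at hp
  intro h
  have h0 : (0 : ℕ) < T.deg v := by lia
  have := (T.nbr_bijOn v).injOn (show p ∈ Set.Iio _ from hp.1) (show (0 : ℕ) ∈ Set.Iio _ from h0) h
  rcases hp.2 with h1 | h1
  · exact hv h1
  · lia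

theorem depth_child {dir : Dir} {v : V} {p : ℕ} (hp : p ∈ T.childPorts dir v) :
    T.depth (T.nbr v p) = T.depth v + 1 := by
  have hadj := T.adj_nbr (T.mem_childPorts.1 hp).1
  rcases T.depth_adj hadj with h | h
  · exfalso
    have hv : v ≠ T.root := by
      rintro rfl
      simp [depth_root] at h
    exact T.child_ne_parent hp hv (T.eq_parent hadj (by lia))
  · exact h

theorem child_ne_root {dir : Dir} {v : V} {p : ℕ} (hp : p ∈ T.childPorts dir v) :
    T.nbr v p ≠ T.root := by
  intro h
  have := T.depth_child hp
  rw [h, depth_root] at this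
  lia

theorem parent_child {dir : Dir} {v : V} {p : ℕ} (hp : p ∈ T.childPorts dir v) :
    T.nbr (T.nbr v p) 0 = v := by
  have hadj := T.adj_nbr (T.mem_childPorts.1 hp).1
  exact (T.eq_parent hadj.symm (by rw [T.depth_child hp]; lia)).symm

theorem child_injective {dir dir' : Dir} {v : V} {p q : ℕ} (hp : p ∈ T.childPorts dir v)
    (hq : q ∈ T.childPorts dir' v) (h : T.nbr v p = T.nbr v q) : p = q :=
  (T.nbr_bijOn v).injOn (show p ∈ Set.Iio _ from (T.mem_childPorts.1 hp).1)
    (show q ∈ Set.Iio _ from (T.mem_childPorts.1 hq).1) h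

theorem exists_childPort (dir : Dir) {c : V} (hc : c ≠ T.root) :
    ∃ p ∈ T.childPorts dir (T.nbr c 0), T.nbr (T.nbr c 0) p = c := by
  have hadj := (T.adj_parent hc).symm
  obtain ⟨p, hp, hpc⟩ := (T.nbr_bijOn (T.nbr c 0)).surjOn hadj
  refine ⟨p, T.mem_childPorts.2 ⟨hp, ?_⟩, hpc⟩
  by_contra! hcon
  have hp0 : p = 0 := by lia
  subst hp0
  have h1 := T.depth_parent hc
  have h2 := T.depth_parent hcon.1
  rw [hpc] at h2
  lia

/-- Induction along the edges from the root to a vertex. -/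
theorem parent_induction {P : V → Prop} (root : P T.root)
    (step : ∀ v, v ≠ T.root → P (T.nbr v 0) → P v) (v : V) : P v := by
  induction h : T.depth v generalizing v with
  | zero =>
    by_cases hv : v = T.root
    · exact hv ▸ root
    · exact absurd (depth_pos hv) (by lia)
  | succ n ih =>
    have hv : v ≠ T.root := by
      rintro rfl
      simp [depth_root] at h
    exact step v hv (ih _ (by have := T.depth_parent hv; lia))

theorem mem_below_self (v : V) : v ∈ T.below v := by simp [below]

theorem mem_below_root (v : V) : v ∈ T.below T.root := by
  simp [below, depth]

variable {T} in
theorem depth_le_of_mem_below {v w : V} (h : w ∈ T.below v) : T.depth v ≤ T.depth w := by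
  simp only [below, Set.mem_ofPred_eq] at h
  lia

variable {T} in
theorem eq_of_mem_below_of_depth_le {v w : V} (h : w ∈ T.below v) (hd : T.depth w ≤ T.depth v) :
    w = v := by
  simp only [below, Set.mem_ofPred_eq] at h
  exact (T.isTree.connected.dist_eq_zero_iff.1 (by lia)).symm

variable {T} in
theorem mem_below_of_parent {v w : V} (hw : w ≠ T.root) (h : T.nbr w 0 ∈ T.below v) :
    w ∈ T.below v := by
  simp only [below, Set.mem_ofPred_eq] at h ⊢
  have h1 := T.depth_parent hw
  have h2 : T.depth w ≤ T.depth v + T.graph.dist v w := T.isTree.connected.dist_triangle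
  have h3 : T.graph.dist v w ≤ T.graph.dist v (T.nbr w 0) + T.graph.dist (T.nbr w 0) w :=
    T.isTree.connected.dist_triangle
  have h4 : T.graph.dist (T.nbr w 0) w = 1 :=
    SimpleGraph.dist_eq_one_iff_adj.2 (T.adj_parent hw).symm
  lia

variable {T} in
theorem parent_mem_below {v w : V} (h : w ∈ T.below v) (hne : w ≠ v) : T.nbr w 0 ∈ T.below v := by
  obtain ⟨q, hq⟩ := T.isTree.connected.exists_walk_length_eq_dist v w
  have hnil : ¬ q.Nil := fun hn => hne hn.eq.symm
  have hadj := q.adj_penultimate hnil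
  have hpos : 0 < q.length := SimpleGraph.Walk.not_nil_iff_lt_length.1 hnil
  have hlen : q.dropLast.length + 1 = q.length := by
    rw [SimpleGraph.Walk.length_dropLast]
    lia
  have h1 : T.graph.dist v q.penultimate ≤ q.dropLast.length := SimpleGraph.dist_le _
  have h2 : T.depth q.penultimate ≤ T.depth v + T.graph.dist v q.penultimate :=
    T.isTree.connected.dist_triangle
  simp only [below, Set.mem_ofPred_eq] at h ⊢
  have h3 : q.penultimate = T.nbr w 0 := T.eq_parent hadj.symm (by lia)
  have h4 := T.depth_adj hadj
  rw [← h3]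
  lia

variable {T} in
theorem ne_root_of_mem_below {v w : V} (h : w ∈ T.below v) (hne : w ≠ v) : w ≠ T.root := by
  rintro rfl
  have := depth_le_of_mem_below h
  rw [depth_root] at this
  exact hne (eq_of_mem_below_of_depth_le h (by rw [depth_root]; lia))

variable {T} in
theorem mem_below_trans {u v w : V} (h₁ : v ∈ T.below u) (h₂ : w ∈ T.below v) : w ∈ T.below u := by
  revert h₂
  induction w using T.parent_induction with
  | root =>
    intro h₂
    by_cases hv : T.root = v
    · exact hv ▸ h₁
    · exact absurd rfl (ne_root_of_mem_below h₂ hv)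
  | step w hw ih =>
    intro h₂
    by_cases hv : w = v
    · exact hv ▸ h₁
    · exact mem_below_of_parent hw (ih (parent_mem_below h₂ hv))

variable {T} in
theorem child_mem_below {dir : Dir} {v : V} {p : ℕ} (hp : p ∈ T.childPorts dir v) :
    T.nbr v p ∈ T.below v :=
  mem_below_of_parent (T.child_ne_root hp) (by rw [T.parent_child hp]; exact T.mem_below_self v)

variable {T} in
theorem below_child_subset {dir : Dir} {v : V} {p : ℕ} (hp : p ∈ T.childPorts dir v) :
    T.below (T.nbr v p) ⊆ T.below v :=
  fun _ => mem_below_trans (child_mem_below hp)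

variable {T} in
theorem eq_or_mem_below_child (dir : Dir) {v w : V} (h : w ∈ T.below v) :
    w = v ∨ ∃ p ∈ T.childPorts dir v, w ∈ T.below (T.nbr v p) := by
  revert h
  induction w using T.parent_induction with
  | root =>
    intro h
    by_cases hv : T.root = v
    · exact .inl hv
    · exact absurd rfl (ne_root_of_mem_below h hv)
  | step w hw ih =>
    intro h
    by_cases hv : w = v
    · exact .inl hv
    right
    rcases ih (parent_mem_below h hv) with h1 | ⟨p, hp, h1⟩
    · obtain ⟨p, hp, hpw⟩ := T.exists_childPort dir hw
      rw [h1] at hp hpw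
      exact ⟨p, hp, hpw ▸ T.mem_below_self _⟩
    · exact ⟨p, hp, mem_below_of_parent hw h1⟩

variable {T} in
/-- Two ancestors of a vertex are comparable. -/
theorem mem_below_or_mem_below {a b w : V} (ha : w ∈ T.below a) (hb : w ∈ T.below b) :
    a ∈ T.below b ∨ b ∈ T.below a := by
  revert ha hb
  induction w using T.parent_induction with
  | root =>
    intro ha hb
    by_cases hv : T.root = a
    · subst hv; exact .inl hb
    · exact absurd rfl (ne_root_of_mem_below ha hv)
  | step w hw ih =>
    intro ha hb
    by_cases hwa : w = a
    · subst hwa; exact .inl hb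
    by_cases hwb : w = b
    · subst hwb; exact .inr ha
    exact ih (parent_mem_below ha hwa) (parent_mem_below hb hwb)

variable {T} in
theorem eq_of_mem_below_of_depth_eq {a b w : V} (ha : w ∈ T.below a) (hb : w ∈ T.below b)
    (h : T.depth a = T.depth b) : a = b := by
  rcases mem_below_or_mem_below ha hb with h1 | h1
  · exact eq_of_mem_below_of_depth_le h1 h.le
  · exact (eq_of_mem_below_of_depth_le h1 h.ge).symm

variable {T} in
theorem mem_below_of_depth_le {a b w : V} (ha : w ∈ T.below a) (hb : w ∈ T.below b)
    (h : T.depth a ≤ T.depth b) : b ∈ T.below a := by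
  rcases mem_below_or_mem_below ha hb with h1 | h1
  · rw [eq_of_mem_below_of_depth_le h1 h]; exact T.mem_below_self _
  · exact h1

variable {T} in
theorem childPort_eq {dir dir' : Dir} {v w : V} {p q : ℕ} (hp : p ∈ T.childPorts dir v)
    (hq : q ∈ T.childPorts dir' v) (h₁ : w ∈ T.below (T.nbr v p)) (h₂ : w ∈ T.below (T.nbr v q)) :
    p = q :=
  T.child_injective hp hq (eq_of_mem_below_of_depth_eq h₁ h₂ (by
    rw [T.depth_child hp, T.depth_child hq]))

variable {T} in
theorem not_mem_below_child {dir : Dir} {v : V} {p : ℕ} (hp : p ∈ T.childPorts dir v) :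
    v ∉ T.below (T.nbr v p) := by
  intro h
  have := depth_le_of_mem_below h
  rw [T.depth_child hp] at this
  lia

/-- Two vertices are comparable, or the paths to them branch at some vertex. -/
theorem comparable_or_branch (x w : V) :
    w ∈ T.below x ∨ x ∈ T.below w ∨ ∃ a, ∃ p ∈ T.childPorts .left a, ∃ q ∈ T.childPorts .left a,
      p ≠ q ∧ x ∈ T.below (T.nbr a p) ∧ w ∈ T.below (T.nbr a q) := by
  induction w using T.parent_induction with
  | root => exact .inr (.inl (T.mem_below_root x))
  | step w hw ih =>
    rcases ih with h | h | ⟨a, p, hp, q, hq, hpq, hx, hw'⟩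
    · exact .inl (mem_below_of_parent hw h)
    · obtain ⟨q, hq, hqw⟩ := T.exists_childPort .left hw
      rcases eq_or_mem_below_child .left h with h1 | ⟨p, hp, h1⟩
      · left
        rw [h1]
        exact mem_below_of_parent hw (T.mem_below_self _)
      · by_cases hpq : p = q
        · rw [hpq, hqw] at h1
          exact .inr (.inl h1)
        · refine .inr (.inr ⟨_, p, hp, q, hq, hpq, h1, ?_⟩)
          rw [hqw]
          exact T.mem_below_self _
    · exact .inr (.inr ⟨a, p, hp, q, hq, hpq, hx, mem_below_of_parent hw hw'⟩)

theorem depth_lt_card (v : V) : T.depth v < Fintype.card V := by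
  classical
  obtain ⟨p, hp, hlen⟩ := T.isTree.connected.exists_path_of_dist T.root v
  have := hp.length_lt
  unfold depth
  lia

variable {T} in
/-- The ancestors of a vertex have different depths. -/
theorem depth_injOn_ancestors (v : V) : Set.InjOn T.depth {a | v ∈ T.below a} :=
  fun _ ha _ hb h => eq_of_mem_below_of_depth_eq ha hb h

theorem exists_ancestor (v : V) {n : ℕ} (hn : n ≤ T.depth v) : ∃ a, v ∈ T.below a ∧ T.depth a = n := by
  induction v using T.parent_induction with
  | root => exact ⟨T.root, T.mem_below_self _, by rw [depth_root] at *; lia⟩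
  | step v hv ih =>
    have h1 := T.depth_parent hv
    rcases Nat.lt_or_ge (T.depth (T.nbr v 0)) n with h | h
    · exact ⟨v, T.mem_below_self _, by lia⟩
    · obtain ⟨a, ha, hd⟩ := ih h
      exact ⟨a, mem_below_of_parent hv ha, hd⟩

theorem image_depth_ancestors (v : V) {n : ℕ} (hn : n ≤ T.depth v) :
    T.depth '' {a | v ∈ T.below a ∧ T.depth a ≤ n} = Set.Iic n := by
  ext m
  constructor
  · rintro ⟨a, ⟨-, ha⟩, rfl⟩
    exact ha
  · intro hm
    obtain ⟨a, ha, hd⟩ := T.exists_ancestor v (le_trans hm hn)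
    exact ⟨a, ⟨ha, hd ▸ hm⟩, hd⟩

/-- A walk from the root to `v` visits all of these vertices. The count yields both bounds on what a
walk collects and the price of lowering a root. -/
theorem ncard_ancestors (v : V) {n : ℕ} (hn : n ≤ T.depth v) :
    {a | v ∈ T.below a ∧ T.depth a ≤ n}.ncard = n + 1 := by
  rw [← Set.InjOn.ncard_image ((depth_injOn_ancestors v).mono fun a ha => ha.1),
    T.image_depth_ancestors v hn]
  simp [Set.ncard_eq_toFinset_card']

end PortTree

/-! ### Search directions and the order in which they consider ports -/

namespace Dir

/-- The opposite search direction. -/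
def swap : Dir → Dir
  | left => right
  | right => left

/-- `dir.Before p q` means that a search in direction `dir` considers port `p` before port `q`. -/
def Before : Dir → ℕ → ℕ → Prop
  | left, p, q => p < q
  | right, p, q => q < p

theorem before_or_before (dir : Dir) {p q : ℕ} (h : p ≠ q) : dir.Before p q ∨ dir.Before q p := by
  cases dir <;> simp only [Before] <;> lia

theorem before_swap {dir : Dir} {p q : ℕ} : dir.swap.Before p q ↔ dir.Before q p := by
  cases dir <;> rfl

theorem swap_ne (dir : Dir) : dir.swap ≠ dir := by
  cases dir <;> simp [swap]

theorem eq_or_eq_swap (dir d : Dir) : d = dir ∨ d = dir.swap := by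
  cases dir <;> cases d <;> simp [swap]

instance : DecidableEq Dir := fun a b =>
  match a, b with
  | left, left => isTrue rfl
  | right, right => isTrue rfl
  | left, right => isFalse (by simp)
  | right, left => isFalse (by simp)

end Dir

namespace PortTree

variable {V : Type*} [Fintype V] (T : PortTree V)

theorem childPorts_pairwise (dir : Dir) (v : V) : (T.childPorts dir v).Pairwise dir.Before := by
  have h : (T.childPorts .left v).Pairwise (· < ·) := by
    simp only [childPorts]
    exact List.Pairwise.filter _ (List.pairwise_lt_range)
  cases dir with
  | left => exact h
  | right => exact List.pairwise_reverse.2 h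

theorem mem_childPorts_iff {dir : Dir} (dir' : Dir) {v : V} {p : ℕ} :
    p ∈ T.childPorts dir v ↔ p ∈ T.childPorts dir' v := by
  rw [mem_childPorts, mem_childPorts]

/-! ### Partially explored subtrees -/

/-- The part of `S` below `u` is completely explored. -/
def Closed (S : Subtree V) (X : Set V) (u : V) : Prop := S.verts ∩ T.below u ⊆ X

/-- `S` consists of its root and of the complete subtrees below some children of its root. -/
structure IsPart (S : Subtree V) : Prop where
  root_mem : S.root ∈ S.verts
  subset_below : S.verts ⊆ T.below S.root
  below_subset : ∀ w ∈ S.verts, w ≠ S.root → T.below w ⊆ S.verts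
  parent_mem : ∀ w ∈ S.verts, w ≠ S.root → T.nbr w 0 ∈ S.verts

/-- The parent of every vertex in `X` belongs to `X`. -/
def AncestorClosed (X : Set V) : Prop := ∀ w ∈ X, w ≠ T.root → T.nbr w 0 ∈ X

/-- All parts of `S` that a search in direction `dir` visits before the path to `y` are explored. -/
def Side (dir : Dir) (S : Subtree V) (X : Set V) (y : V) : Prop :=
  ∀ a, ∀ p ∈ T.childPorts .left a, ∀ q ∈ T.childPorts .left a, dir.Before q p →
    y ∈ T.below (T.nbr a p) → T.Closed S X (T.nbr a q)

/-- `S` has been searched from the left up to `pos .left` and from the right up to `pos .right`. -/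
structure Searched (S : Subtree V) (X : Set V) (pos : Dir → V) : Prop where
  pos_mem : ∀ d, pos d ∈ S.verts
  pos_explored : ∀ d, pos d ∈ X
  side : ∀ d, T.Side d S X (pos d)
  open_ancestor : ∀ u ∈ S.verts, u ∈ X → ¬ T.Closed S X u → ∃ d, pos d ∈ T.below u

variable {T}

theorem Closed.mono {S : Subtree V} {X Y : Set V} {u : V} (h : T.Closed S X u) (hXY : X ⊆ Y) :
    T.Closed S Y u := Set.Subset.trans h hXY

theorem Side.mono {dir : Dir} {S : Subtree V} {X Y : Set V} {y : V} (h : T.Side dir S X y)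
    (hXY : X ⊆ Y) : T.Side dir S Y y :=
  fun a p hp q hq hqp hy => (h a p hp q hq hqp hy).mono hXY

theorem AncestorClosed.mem_of_mem_below {X : Set V} (hX : T.AncestorClosed X) {a w : V} (hw : w ∈ X)
    (h : w ∈ T.below a) : a ∈ X := by
  revert hw h
  induction w using T.parent_induction with
  | root =>
    intro hw h
    by_cases hv : T.root = a
    · exact hv ▸ hw
    · exact absurd rfl (ne_root_of_mem_below h hv)
  | step w hwr ih =>
    intro hw h
    by_cases hv : w = a
    · exact hv ▸ hw
    · exact ih (hX w hw hwr) (parent_mem_below h hv)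

theorem IsPart.mem_of_mem_below {S : Subtree V} (hS : T.IsPart S) {x w : V}
    (hx : x ∈ T.below S.root) (hw : w ∈ S.verts) (h : w ∈ T.below x) : x ∈ S.verts := by
  revert hw h
  induction w using T.parent_induction with
  | root =>
    intro hw h
    by_cases hv : T.root = x
    · exact hv ▸ hw
    · exact absurd rfl (ne_root_of_mem_below h hv)
  | step w hwr ih =>
    intro hw h
    by_cases hv : w = x
    · exact hv ▸ hw
    refine ih (hS.parent_mem w hw ?_) (parent_mem_below h hv)
    rintro rfl
    exact hv (eq_of_mem_below_of_depth_le h (depth_le_of_mem_below hx))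

theorem IsPart.child_mem {S : Subtree V} (hS : T.IsPart S) {X : Set V} {dir : Dir} {v : V} {p : ℕ}
    (hv : v ∈ S.verts) (hp : p ∈ T.childPorts dir v) (h : ¬ T.Closed S X (T.nbr v p)) :
    T.nbr v p ∈ S.verts := by
  obtain ⟨w, ⟨hwS, hwb⟩, -⟩ := Set.not_subset.1 h
  exact hS.mem_of_mem_below (below_child_subset hp |>.trans
    (fun x hx => mem_below_trans (hS.subset_below hv) hx) (T.mem_below_self _)) hwS hwb

theorem closed_root_iff {S : Subtree V} (hS : T.IsPart S) {X : Set V} :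
    T.Closed S X S.root ↔ S.verts ⊆ X := by
  rw [Closed, Set.inter_eq_left.2 hS.subset_below]

theorem mem_openPorts {dir : Dir} {S : Subtree V} {X : Set V} {v : V} {p : ℕ} :
    p ∈ T.openPorts dir S X v ↔ p ∈ T.childPorts dir v ∧ ¬ T.Closed S X (T.nbr v p) := by
  simp [openPorts, Closed]

theorem exists_openPort (dir : Dir) {S : Subtree V} {X : Set V} {v : V} (hv : v ∈ X)
    (h : ¬ T.Closed S X v) : ∃ p, p ∈ T.openPorts dir S X v := by
  obtain ⟨w, ⟨hwS, hwb⟩, hwX⟩ := Set.not_subset.1 h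
  rcases eq_or_mem_below_child dir hwb with rfl | ⟨p, hp, hwp⟩
  · exact absurd hv hwX
  · exact ⟨p, mem_openPorts.2 ⟨hp, fun hc => hwX (hc ⟨hwS, hwp⟩)⟩⟩

/-- An agent at an explored vertex with unexplored vertices below it moves to the first child with
unexplored vertices below. -/
theorem dfsMove_of_not_closed {dir : Dir} {S : Subtree V} {X : Set V} {v : V} (hv : v ∈ X)
    (h : ¬ T.Closed S X v) : ∃ p ∈ T.childPorts .left v, T.dfsMove dir S X v = T.nbr v p ∧
      ¬ T.Closed S X (T.nbr v p) ∧
      ∀ q ∈ T.childPorts .left v, dir.Before q p → T.Closed S X (T.nbr v q) := by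
  obtain ⟨p₀, hp₀⟩ := exists_openPort dir hv h
  have hpw : (T.openPorts dir S X v).Pairwise dir.Before :=
    (T.childPorts_pairwise dir v).filter _
  have hmove : T.dfsMove dir S X v = T.nbr v ((T.openPorts dir S X v).headD 0) :=
    if_neg h
  cases hl : T.openPorts dir S X v with
  | nil => simp [hl] at hp₀
  | cons p l =>
    rw [hl] at hmove hpw
    have hp : p ∈ T.openPorts dir S X v := by simp [hl]
    rw [mem_openPorts] at hp
    refine ⟨p, (T.mem_childPorts_iff _).1 hp.1, hmove, hp.2, fun q hq hqp => ?_⟩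
    by_contra hc
    have hq' : q ∈ T.openPorts dir S X v :=
      mem_openPorts.2 ⟨(T.mem_childPorts_iff _).1 hq, hc⟩
    rw [hl, List.mem_cons] at hq'
    have hirr : ¬ (dir.Before p q ∧ dir.Before q p) := by
      cases dir <;> simp only [Dir.Before] <;> lia
    rcases hq' with rfl | hq'
    · exact hirr ⟨hqp, hqp⟩
    · exact hirr ⟨List.rel_of_pairwise_cons hpw hq', hqp⟩

theorem dfsMove_of_closed {dir : Dir} {S : Subtree V} {X : Set V} {v : V}
    (h : T.Closed S X v) : T.dfsMove dir S X v = T.nbr v 0 := if_pos h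

/-- One step of a search upwards. -/
theorem Searched.move_up {S : Subtree V} {X : Set V} {pos : Dir → V} (h : T.Searched S X pos)
    (hS : T.IsPart S) (hX : T.AncestorClosed X) {dir : Dir} (hne : ¬ S.verts ⊆ X)
    (hc : T.Closed S X (pos dir)) :
    pos dir ≠ S.root ∧ pos dir ≠ T.root ∧ T.nbr (pos dir) 0 ∈ X ∧
      T.Searched S X (Function.update pos dir (T.nbr (pos dir) 0)) := by
  have hr : pos dir ≠ S.root := fun hr => hne ((closed_root_iff hS).1 (hr ▸ hc))
  have hr' : pos dir ≠ T.root := ne_root_of_mem_below (hS.subset_below (h.pos_mem dir)) hr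
  have hpX := hX _ (h.pos_explored dir) hr'
  refine ⟨hr, hr', hpX, ⟨fun d => ?_, fun d => ?_, fun d => ?_, fun u hu huX ho => ?_⟩⟩
  · by_cases hd : d = dir
    · subst hd
      simpa using hS.parent_mem _ (h.pos_mem d) hr
    · simpa [hd] using h.pos_mem d
  · by_cases hd : d = dir
    · subst hd
      simpa using hpX
    · simpa [hd] using h.pos_explored d
  · by_cases hd : d = dir
    · subst hd
      intro a p hp q hq hqp hy
      rw [Function.update_self] at hy
      exact h.side d a p hp q hq hqp (mem_below_of_parent hr' hy)
    · simpa [hd] using h.side d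
  · obtain ⟨d, hd⟩ := h.open_ancestor u hu huX ho
    refine ⟨d, ?_⟩
    by_cases hdd : d = dir
    · subst hdd
      rw [Function.update_self]
      refine parent_mem_below hd ?_
      rintro rfl
      exact ho hc
    · simpa [hdd] using hd

/-- One step of a search downwards. -/
theorem Searched.move_down {S : Subtree V} {X : Set V} {pos : Dir → V} (h : T.Searched S X pos)
    (hS : T.IsPart S) {dir : Dir} {p : ℕ} (hp : p ∈ T.childPorts .left (pos dir))
    (ho : ¬ T.Closed S X (T.nbr (pos dir) p))
    (hbefore : ∀ q ∈ T.childPorts .left (pos dir), dir.Before q p →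
      T.Closed S X (T.nbr (pos dir) q)) :
    T.Searched S (insert (T.nbr (pos dir) p) X)
      (Function.update pos dir (T.nbr (pos dir) p)) := by
  have hsub : X ⊆ insert (T.nbr (pos dir) p) X := Set.subset_insert _ _
  refine ⟨fun d => ?_, fun d => ?_, fun d => ?_, fun u hu huX hou => ?_⟩
  · by_cases hd : d = dir
    · subst hd
      simpa using hS.child_mem (h.pos_mem d) hp ho
    · simpa [hd] using h.pos_mem d
  · by_cases hd : d = dir
    · subst hd
      simp
    · simpa [hd] using .inr (h.pos_explored d)
  · by_cases hd : d = dir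
    · subst hd
      intro a p' hp' q hq hqp hy
      rw [Function.update_self] at hy
      -- At the old position the earlier ports are closed because `p` is the first open one; at
      -- branchings further up the condition is inherited from the old position.
      by_cases hy' : T.nbr (pos d) p = T.nbr a p'
      · have ha : pos d = a := by
          rw [← T.parent_child hp, hy', T.parent_child hp']
        subst ha
        obtain rfl := T.child_injective hp hp' hy'
        exact (hbefore q hq hqp).mono hsub
      · have := parent_mem_below hy hy'
        rw [T.parent_child hp] at this
        exact (h.side d a p' hp' q hq hqp this).mono hsub
    · simpa [hd] using (h.side d).mono hsub
  · rcases huX with rfl | huX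
    · exact ⟨dir, by simpa using T.mem_below_self _⟩
    · obtain ⟨d, hd⟩ := h.open_ancestor u hu huX (fun hc => hou (hc.mono hsub))
      refine ⟨d, ?_⟩
      by_cases hdd : d = dir
      · subst hdd
        rw [Function.update_self]
        exact mem_below_trans hd (child_mem_below hp)
      · simpa [hdd] using hd

/-- If the searches from both sides have reached positions below `c`, then all unexplored vertices
of `S` lie below `c`. -/
theorem Searched.unexplored_subset_below {S : Subtree V} {X : Set V} {pos : Dir → V}
    (h : T.Searched S X pos) (hX : T.AncestorClosed X) {c : V} (hcX : c ∈ X)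
    (hc : ∀ d, pos d ∈ T.below c) : S.verts \ X ⊆ T.below c := by
  rintro w ⟨hwS, hwX⟩
  rcases T.comparable_or_branch c w with h1 | h1 | ⟨a, p, hp, q, hq, hpq, hcp, hwq⟩
  · exact h1
  · exact absurd (hX.mem_of_mem_below hcX h1) hwX
  · exfalso
    rcases Dir.before_or_before .left hpq with hb | hb
    · exact hwX (h.side .right a p hp q hq hb (mem_below_trans hcp (hc _)) ⟨hwS, hwq⟩)
    · exact hwX (h.side .left a p hp q hq hb (mem_below_trans hcp (hc _)) ⟨hwS, hwq⟩)

/-- The state of the search of `S` after some agents of direction `dir` have been called. The number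
`j` counts moves to children that had been explored before; they all lead into the part below a
vertex `c` that contains all unexplored vertices. -/
structure SearchState (T : PortTree V) (S : Subtree V) (X : Set V) (pos : Dir → V) (c : V) (j : ℕ) :
    Prop where
  searched : T.Searched S X pos
  mem : c ∈ S.verts
  pos_mem_below : ∀ d, pos d ∈ T.below c
  le_depth : T.depth S.root + j ≤ T.depth c

/-- A move changes the depth by one, so until the energy is used up the depth changes by twice the
number of downward moves minus `e`. A downward move either explores a vertex or is counted by `j`,
whence the last inequality. A move to an explored child with unexplored vertices below it requires a
search position below that child, by `open_ancestor`. This must be the position of the opposite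
search, so both positions then lie below the child, which becomes the new `c`. -/
theorem dfsLoop_spec {S : Subtree V} (hS : T.IsPart S) (dir : Dir) (B e : ℕ) (X : Set V)
    (pos : Dir → V) (c : V) (j : ℕ) (hX : T.AncestorClosed X)
    (h : T.SearchState S X pos c j) (hB : T.depth (pos dir) + e ≤ B) :
    X ⊆ T.dfsLoop dir S e (pos dir) X ∧ T.dfsLoop dir S e (pos dir) X ⊆ X ∪ S.verts ∧
    T.AncestorClosed (T.dfsLoop dir S e (pos dir) X) ∧
    (∀ w ∈ T.dfsLoop dir S e (pos dir) X, w ∉ X → T.depth w ≤ B) ∧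
    (S.verts ⊆ T.dfsLoop dir S e (pos dir) X ∨ ∃ pos' c' j',
      pos' dir.swap = pos dir.swap ∧
      T.SearchState S (T.dfsLoop dir S e (pos dir) X) pos' c' j' ∧
      T.depth (pos' dir) ≤ B ∧
      2 * X.ncard + 2 * j + e + T.depth (pos' dir) ≤
        2 * (T.dfsLoop dir S e (pos dir) X).ncard + 2 * j' + T.depth (pos dir)) := by
  induction e generalizing X pos c j with
  | zero =>
    simp only [dfsLoop]
    exact ⟨subset_rfl, Set.subset_union_left, hX, fun w hw hw' => absurd hw hw',
      .inr ⟨pos, c, j, rfl, h, by lia, by lia⟩⟩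
  | succ e ih =>
    have hs := h.searched
    by_cases hfull : S.verts ⊆ X
    · simp only [dfsLoop, if_pos hfull]
      exact ⟨subset_rfl, Set.subset_union_left, hX, fun w hw hw' => absurd hw hw', .inl hfull⟩
    simp only [dfsLoop, if_neg hfull]
    by_cases hcl : T.Closed S X (pos dir)
    · obtain ⟨hr, hr', hpX, hs'⟩ := hs.move_up hS hX hfull hcl
      rw [dfsMove_of_closed hcl, Set.insert_eq_self.2 hpX]
      have hd := T.depth_parent hr'
      have hcX : c ∈ X := hX.mem_of_mem_below (hs.pos_explored dir) (h.pos_mem_below dir)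
      have hcb := hs.unexplored_subset_below hX hcX h.pos_mem_below
      -- All unexplored vertices of `S` lie below `c`, so a search that has to move up from `c`
      -- would already be complete.
      have hne : pos dir ≠ c := by
        rintro rfl
        refine hfull fun w hw => ?_
        by_contra hwX
        exact hwX (hcl ⟨hw, hcb ⟨hw, hwX⟩⟩)
      have h' : T.SearchState S X (Function.update pos dir (T.nbr (pos dir) 0)) c j := by
        refine ⟨hs', h.mem, fun d => ?_, h.le_depth⟩
        by_cases hdd : d = dir
        · subst hdd
          simpa using parent_mem_below (h.pos_mem_below d) hne
        · simpa [hdd] using h.pos_mem_below d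
      have := ih X _ c j hX h' (by simp only [Function.update_self]; lia)
      simp only [Function.update_self, Function.update_of_ne dir.swap_ne] at this
      obtain ⟨i1, i2, i3, i4, i5⟩ := this
      refine ⟨i1, i2, i3, i4, i5.imp id ?_⟩
      rintro ⟨pos', c', j', k1, k2, k3, k4⟩
      exact ⟨pos', c', j', k1, k2, k3, by lia⟩
    · obtain ⟨p, hp, hmove, ho, hbefore⟩ := dfsMove_of_not_closed (dir := dir) (hs.pos_explored dir) hcl
      rw [hmove]
      have hs' := hs.move_down hS hp ho hbefore
      have hchild := hS.child_mem (hs.pos_mem dir) hp ho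
      have hd := T.depth_child hp
      have hX' : T.AncestorClosed (insert (T.nbr (pos dir) p) X) := by
        rintro w (rfl | hw) hwr
        · rw [T.parent_child hp]
          exact .inr (hs.pos_explored dir)
        · exact .inr (hX w hw hwr)
      obtain ⟨c₁, j₁, h', hj⟩ : ∃ c₁ j₁, T.SearchState S (insert (T.nbr (pos dir) p) X)
          (Function.update pos dir (T.nbr (pos dir) p)) c₁ j₁ ∧
          2 * X.ncard + 2 * j + 2 ≤ 2 * (insert (T.nbr (pos dir) p) X).ncard + 2 * j₁ := by
        by_cases hpX : T.nbr (pos dir) p ∈ X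
        · obtain ⟨d, hdb⟩ := hs.open_ancestor _ hchild hpX ho
          -- The explored child lies strictly below the old `c`, so `le_depth` survives the increase
          -- of `j`.
          refine ⟨T.nbr (pos dir) p, j + 1, ⟨hs', hchild, fun d' => ?_, ?_⟩, ?_⟩
          · by_cases hdd : d' = dir
            · subst hdd
              simpa using T.mem_below_self _
            · have hdne : d ≠ dir := by
                rintro rfl
                exact not_mem_below_child hp hdb
              have : d' = d := by
                rcases Dir.eq_or_eq_swap dir d with h1 | h1
                · exact absurd h1 hdne
                · rcases Dir.eq_or_eq_swap dir d' with h2 | h2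
                  · exact absurd h2 hdd
                  · rw [h1, h2]
              rw [Function.update_of_ne hdd, this]
              exact hdb
          · have h1 := h.le_depth
            have h2 := depth_le_of_mem_below (h.pos_mem_below dir)
            lia
          · rw [Set.insert_eq_self.2 hpX]
            lia
        · refine ⟨c, j, ⟨hs', h.mem, fun d' => ?_, h.le_depth⟩, ?_⟩
          · by_cases hdd : d' = dir
            · subst hdd
              simpa using mem_below_trans (h.pos_mem_below d') (child_mem_below hp)
            · simpa [hdd] using h.pos_mem_below d'
          · rw [Set.ncard_insert_of_notMem hpX (Set.toFinite _)]
            lia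
      have := ih _ _ c₁ j₁ hX' h' (by simp only [Function.update_self]; lia)
      simp only [Function.update_self, Function.update_of_ne dir.swap_ne] at this
      obtain ⟨i1, i2, i3, i4, i5⟩ := this
      refine ⟨(Set.subset_insert _ _).trans i1, i2.trans ?_, i3, fun w hw hwX => ?_, i5.imp id ?_⟩
      · rintro w ((rfl | hw) | hw)
        · exact .inr hchild
        · exact .inl hw
        · exact .inr hw
      · by_cases hwp : w = T.nbr (pos dir) p
        · rw [hwp]
          lia
        · exact i4 w hw (by rintro (h1 | h1); exacts [hwp h1, hwX h1])
      · rintro ⟨pos', c', j', k1, k2, k3, k4⟩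
        exact ⟨pos', c', j', k1, k2, k3, by lia⟩

end PortTree

namespace PortTree

variable {V : Type*} [Fintype V] (T : PortTree V)

/-! ### Moving down the root of a subtree -/

/-- The inner while-loop does not change `S`: whenever a child of the root is explored and has
unexplored vertices below it, then another child of the root has unexplored vertices below it. -/
def Stable (S : Subtree V) (X : Set V) : Prop :=
  ∀ p ∈ T.childPorts .left S.root, T.nbr S.root p ∈ X → ¬ T.Closed S X (T.nbr S.root p) →
    ∃ q ∈ T.childPorts .left S.root, q ≠ p ∧ ¬ T.Closed S X (T.nbr S.root q)

variable {T}

theorem openPorts_eq_singleton_iff {S : Subtree V} {X : Set V} {v : V} {p : ℕ} :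
    T.openPorts .left S X v = [p] ↔ p ∈ T.childPorts .left v ∧ ¬ T.Closed S X (T.nbr v p) ∧
      ∀ q ∈ T.childPorts .left v, ¬ T.Closed S X (T.nbr v q) → q = p := by
  constructor
  · intro h
    have hp := mem_openPorts.1 (show p ∈ T.openPorts .left S X v by simp [h])
    refine ⟨hp.1, hp.2, fun q hq hqo => ?_⟩
    have := mem_openPorts.2 ⟨hq, hqo⟩
    simpa [h] using this
  · rintro ⟨hp, hpo, hq⟩
    have hpw : (T.openPorts .left S X v).Pairwise Dir.left.Before :=
      (T.childPorts_pairwise .left v).filter _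
    have hmem : ∀ q, q ∈ T.openPorts .left S X v ↔ q = p := fun q =>
      ⟨fun h => hq q (mem_openPorts.1 h).1 (mem_openPorts.1 h).2, fun h =>
        h ▸ mem_openPorts.2 ⟨hp, hpo⟩⟩
    cases hl : T.openPorts .left S X v with
    | nil => simp [hl] at hmem
    | cons a l =>
      rw [hl] at hmem hpw
      have ha : a = p := (hmem a).1 (by simp)
      cases l with
      | nil => rw [ha]
      | cons b l =>
        have hb : b = p := (hmem b).1 (by simp)
        have := List.rel_of_pairwise_cons hpw (show b ∈ b :: l by simp)
        simp [Dir.Before, ha, hb] at this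

theorem moveDownAux_of_stable {S : Subtree V} {X : Set V} (h : T.Stable S X) (n : ℕ) :
    T.moveDownAux X n S = S := by
  cases n with
  | zero => rfl
  | succ n =>
    rw [moveDownAux]
    split
    · rename_i p hp
      obtain ⟨h1, h2, h3⟩ := openPorts_eq_singleton_iff.1 hp
      rw [if_neg]
      intro hX
      obtain ⟨q, hq, hqp, hqo⟩ := h p h1 hX h2
      exact hqp (h3 q hq hqo)
    · rfl

theorem moveDownAux_of_not_stable {S : Subtree V} {X : Set V} (h : ¬ T.Stable S X) :
    ∃ p ∈ T.childPorts .left S.root, T.nbr S.root p ∈ X ∧ ¬ T.Closed S X (T.nbr S.root p) ∧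
      (∀ q ∈ T.childPorts .left S.root, ¬ T.Closed S X (T.nbr S.root q) → q = p) ∧
      ∀ n, T.moveDownAux X (n + 1) S =
        T.moveDownAux X n ⟨T.nbr S.root p, T.below (T.nbr S.root p)⟩ := by
  simp only [Stable, not_forall] at h
  obtain ⟨p, hp, hpX, hpo, hq⟩ := h
  have hq' : ∀ q ∈ T.childPorts .left S.root, ¬ T.Closed S X (T.nbr S.root q) → q = p := by
    intro q hqc hqo
    by_contra hne
    exact hq ⟨q, hqc, hne, hqo⟩
  refine ⟨p, hp, hpX, hpo, hq', fun n => ?_⟩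
  rw [moveDownAux, openPorts_eq_singleton_iff.2 ⟨hp, hpo, hq'⟩]
  simp [hpX]

/-- Every replacement lowers the root by one level and no depth reaches the number of vertices, so
the iteration bound is never what stops the loop. -/
theorem stable_moveDownAux (X : Set V) (n : ℕ) (S : Subtree V)
    (hn : Fintype.card V ≤ n + T.depth S.root) : T.Stable (T.moveDownAux X n S) X := by
  induction n generalizing S with
  | zero => exact absurd (T.depth_lt_card S.root) (by lia)
  | succ n ih =>
    by_cases h : T.Stable S X
    · rwa [moveDownAux_of_stable h]
    · obtain ⟨p, hp, -, -, -, hm⟩ := moveDownAux_of_not_stable h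
      rw [hm]
      exact ih _ (by simp only [T.depth_child hp]; lia)

theorem stable_moveDown (X : Set V) (S : Subtree V) : T.Stable (T.moveDown X S) X :=
  stable_moveDownAux X _ S (by lia)

theorem moveDown_of_stable {S : Subtree V} {X : Set V} (h : T.Stable S X) : T.moveDown X S = S :=
  moveDownAux_of_stable h _

theorem stable_of_subset {S : Subtree V} {X : Set V} (h : S.verts ⊆ X) : T.Stable S X :=
  fun _ _ _ ho => absurd (Set.inter_subset_left.trans h) ho

/-- The stability of a subtree depends only on the explored vertices in this subtree. -/
theorem Stable.congr {S : Subtree V} (hS : T.IsPart S) {X Y : Set V} (h : T.Stable S X)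
    (hXY : ∀ w ∈ S.verts, w ∈ X ↔ w ∈ Y) : T.Stable S Y := by
  have hcl : ∀ u, T.Closed S X u ↔ T.Closed S Y u := fun u =>
    ⟨fun hc w hw => (hXY w hw.1).1 (hc hw), fun hc w hw => (hXY w hw.1).2 (hc hw)⟩
  intro p hp hpY hpo
  have hmem := hS.child_mem hS.root_mem hp hpo
  obtain ⟨q, hq, hqp, hqo⟩ := h p hp ((hXY _ hmem).2 hpY) (fun hc => hpo ((hcl _).1 hc))
  exact ⟨q, hq, hqp, fun hc => hqo ((hcl _).2 hc)⟩

theorem isPart_below (c : V) : T.IsPart ⟨c, T.below c⟩ where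
  root_mem := T.mem_below_self c
  subset_below := subset_rfl
  below_subset := fun _ hw _ _ hx => mem_below_trans hw hx
  parent_mem := fun _ hw hne => parent_mem_below hw hne

/-- If the root of `S` lies below one child of `a`, then so does all of `S`, and nothing of `S` lies
below another child. -/
theorem side_root {S : Subtree V} (hS : T.IsPart S) (X : Set V) (d : Dir) :
    T.Side d S X S.root := by
  rintro a p hp q hq hqp hy w ⟨hwS, hwb⟩
  have := childPort_eq hp hq (mem_below_trans hy (hS.subset_below hwS)) hwb
  subst this
  cases d <;> simp [Dir.Before] at hqp

theorem Closed.anti {S S' : Subtree V} (h : S'.verts ⊆ S.verts) {X : Set V} {u : V}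
    (hc : T.Closed S X u) : T.Closed S' X u := fun _ hw => hc ⟨h hw.1, hw.2⟩

theorem Side.anti {S S' : Subtree V} (h : S'.verts ⊆ S.verts) {X : Set V} {y : V} {d : Dir}
    (hs : T.Side d S X y) : T.Side d S' X y :=
  fun a p hp q hq hqp hy => (hs a p hp q hq hqp hy).anti h

theorem Searched.root_explored {S : Subtree V} (hS : T.IsPart S) {X : Set V} {pos : Dir → V}
    (hX : T.AncestorClosed X) (h : T.Searched S X pos) : S.root ∈ X :=
  hX.mem_of_mem_below (h.pos_explored .left) (hS.subset_below (h.pos_mem .left))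

/-- The root is explored and only one child is open, so all unexplored vertices survive. A search
position outside the new subtree is replaced by the new root, where the side condition is vacuous;
this is the reason for the maximum in the depth bound. An open vertex of the new subtree keeps its
witness, since a position below such a vertex has not been replaced. -/
theorem moveDownAux_spec {X : Set V} (hX : T.AncestorClosed X) (n : ℕ) {S : Subtree V}
    (hS : T.IsPart S) {pos : Dir → V} (h : T.Searched S X pos) :
    T.IsPart (T.moveDownAux X n S) ∧ (T.moveDownAux X n S).verts ⊆ S.verts ∧
    S.verts \ X ⊆ (T.moveDownAux X n S).verts ∧
    ∃ pos', T.Searched (T.moveDownAux X n S) X pos' ∧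
      ∀ d, T.depth (pos' d) ≤ max (T.depth (pos d)) (T.depth (T.moveDownAux X n S).root) := by
  classical
  induction n generalizing S pos with
  | zero => exact ⟨hS, subset_rfl, Set.sdiff_subset, pos, h, fun d => le_max_left _ _⟩
  | succ n ih =>
    by_cases hst : T.Stable S X
    · rw [moveDownAux_of_stable hst]
      exact ⟨hS, subset_rfl, Set.sdiff_subset, pos, h, fun d => le_max_left _ _⟩
    obtain ⟨p, hp, hpX, hpo, hq, hm⟩ := moveDownAux_of_not_stable hst
    rw [hm]
    set c := T.nbr S.root p with hc
    have hcS : c ∈ S.verts := hS.child_mem hS.root_mem hp hpo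
    have hcr : c ≠ S.root := by
      intro hcr
      have := T.depth_child hp
      rw [← hc, hcr] at this
      lia
    have hsub : T.below c ⊆ S.verts := hS.below_subset c hcS hcr
    have hunexp : S.verts \ X ⊆ T.below c := by
      rintro w ⟨hwS, hwX⟩
      rcases eq_or_mem_below_child .left (hS.subset_below hwS) with rfl | ⟨q, hqc, hwq⟩
      · exact absurd (h.root_explored hS hX) hwX
      · rwa [hq q hqc fun hcl => hwX (hcl ⟨hwS, hwq⟩)] at hwq
    let pos₁ : Dir → V := fun d => if pos d ∈ T.below c then pos d else c
    have hpos₁ : ∀ d, pos d ∈ T.below c → pos₁ d = pos d := fun d hd => if_pos hd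
    have hpos₁' : ∀ d, pos d ∉ T.below c → pos₁ d = c := fun d hd => if_neg hd
    have h₁ : T.Searched ⟨c, T.below c⟩ X pos₁ := by
      refine ⟨fun d => ?_, fun d => ?_, fun d => ?_, fun u hu huX ho => ?_⟩
      · by_cases hd : pos d ∈ T.below c
        · rwa [hpos₁ d hd]
        · rw [hpos₁' d hd]
          exact T.mem_below_self c
      · by_cases hd : pos d ∈ T.below c
        · rw [hpos₁ d hd]
          exact h.pos_explored d
        · rwa [hpos₁' d hd]
      · by_cases hd : pos d ∈ T.below c
        · rw [hpos₁ d hd]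
          exact (h.side d).anti hsub
        · rw [hpos₁' d hd]
          exact side_root (isPart_below c) X d
      · obtain ⟨d, hd⟩ := h.open_ancestor u (hsub hu) huX fun hcl => ho (hcl.anti hsub)
        refine ⟨d, ?_⟩
        rwa [hpos₁ d (mem_below_trans hu hd)]
    obtain ⟨i1, i2, i3, pos', i4, i5⟩ := ih (isPart_below c) h₁
    refine ⟨i1, i2.trans hsub, fun w hw => i3 ⟨hunexp hw, hw.2⟩, pos', i4, fun d => (i5 d).trans ?_⟩
    have hroot := depth_le_of_mem_below (i2 i1.root_mem)
    by_cases hd : pos d ∈ T.below c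
    · rw [hpos₁ d hd]
    · rw [hpos₁' d hd]
      exact max_le (hroot.trans (le_max_right _ _)) (le_max_right _ _)

/-- If all unexplored vertices of a stable subtree lie below an explored vertex `c`, then the root
of the subtree is at least as deep as `c`. -/
theorem Stable.depth_le {S : Subtree V} (hS : T.IsPart S) {X : Set V} (hst : T.Stable S X)
    (hX : T.AncestorClosed X) (hne : ¬ S.verts ⊆ X) {c : V} (hcX : c ∈ X)
    (hc : S.verts \ X ⊆ T.below c) : T.depth c ≤ T.depth S.root := by
  obtain ⟨w, hwS, hwX⟩ := Set.not_subset.1 hne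
  rcases mem_below_or_mem_below (hc ⟨hwS, hwX⟩) (hS.subset_below hwS) with h1 | h1
  · rcases eq_or_mem_below_child .left h1 with rfl | ⟨p, hp, hcp⟩
    · exact le_rfl
    exfalso
    have hwp := mem_below_trans hcp (hc ⟨hwS, hwX⟩)
    -- If `c` were deeper than the root, then the child towards `c` would be explored and open.
    -- Stability would provide a second open child, whose unexplored vertices are not below `c`.
    obtain ⟨q, hq, hqp, hqo⟩ := hst p hp (hX.mem_of_mem_below hcX hcp) fun hcl => hwX (hcl ⟨hwS, hwp⟩)
    obtain ⟨x, ⟨hxS, hxq⟩, hxX⟩ := Set.not_subset.1 hqo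
    exact hqp (childPort_eq hq hp hxq (mem_below_trans hcp (hc ⟨hxS, hxX⟩)))
  · exact depth_le_of_mem_below h1

/-! ### The leftmost and the rightmost unexplored vertex -/

/-- The edges back to `v` are never found because `v` is explored, so finding the first edge is a
recursion over the children in search order. All children before the successful one are closed. The
bound on `n` excludes the truncated case, as no vertex is that deep. -/
theorem find_dfsSeqAux {S : Subtree V} (hS : T.IsPart S) (X : Set V) (dir : Dir) (n : ℕ) (v : V)
    (hn : Fintype.card V ≤ n + T.depth v) (hvS : v ∈ S.verts) (hvX : v ∈ X) (P : V × V → Bool)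
    (hP : ∀ e, P e = true ↔ e.2 ∉ X) :
    ((T.dfsSeqAux dir S n v).find? P = none → T.Closed S X v) ∧
    ∀ e, (T.dfsSeqAux dir S n v).find? P = some e →
      e.2 ∈ S.verts ∧ e.2 ∈ T.below v ∧ e.2 ∉ X ∧ e.2 ≠ T.root ∧ T.nbr e.2 0 ∈ X ∧
      ∀ a ∈ T.below v, ∀ p ∈ T.childPorts .left a, ∀ q ∈ T.childPorts .left a, dir.Before q p →
        e.2 ∈ T.below (T.nbr a p) → T.Closed S X (T.nbr a q) := by
  classical
  induction n generalizing v with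
  | zero => exact absurd (T.depth_lt_card v) (by lia)
  | succ n ih =>
    rw [dfsSeqAux, List.find?_flatMap]
    set l := (T.childPorts dir v).filter fun p => @decide (T.nbr v p ∈ S.verts) (Classical.propDecidable _)
      with hl
    have hmem : ∀ p, p ∈ l ↔ p ∈ T.childPorts dir v ∧ T.nbr v p ∈ S.verts := by
      intro p
      simp [hl]
    have hpw : l.Pairwise dir.Before := (T.childPorts_pairwise dir v).filter _
    have hfind : ∀ p, ((v, T.nbr v p) :: (T.dfsSeqAux dir S n (T.nbr v p) ++ [(T.nbr v p, v)])).find? P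
        = if T.nbr v p ∈ X then (T.dfsSeqAux dir S n (T.nbr v p)).find? P
          else some (v, T.nbr v p) := by
      intro p
      have hv : P (T.nbr v p, v) = false := by
        rw [Bool.eq_false_iff, Ne, hP]
        simpa using hvX
      by_cases hpX : T.nbr v p ∈ X
      · have : P (v, T.nbr v p) = false := by
          rw [Bool.eq_false_iff, Ne, hP]
          simpa using hpX
        rw [if_pos hpX, List.find?_cons_of_neg (by simp [this]), List.find?_append]
        simp [hv]
      · rw [if_neg hpX, List.find?_cons_of_pos ((hP _).2 hpX)]
    simp only [hfind]
    have hchild : ∀ p ∈ l, (if T.nbr v p ∈ X then (T.dfsSeqAux dir S n (T.nbr v p)).find? P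
          else some (v, T.nbr v p)) = none → T.Closed S X (T.nbr v p) := by
      intro p hp hnone
      split_ifs at hnone with hpX
      exact (ih _ (by rw [T.depth_child ((hmem p).1 hp).1]; lia) ((hmem p).1 hp).2 hpX).1 hnone
    have hnotmem : ∀ q ∈ T.childPorts dir v, q ∉ l → T.Closed S X (T.nbr v q) := by
      intro q hq hql
      by_contra hqo
      exact hql ((hmem q).2 ⟨hq, hS.child_mem hvS hq hqo⟩)
    constructor
    · intro hnone
      rw [List.findSome?_eq_none_iff] at hnone
      rintro w ⟨hwS, hwb⟩
      rcases eq_or_mem_below_child dir hwb with rfl | ⟨q, hq, hwq⟩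
      · exact hvX
      by_cases hql : q ∈ l
      · exact hchild q hql (hnone q hql) ⟨hwS, hwq⟩
      · exact hnotmem q hq hql ⟨hwS, hwq⟩
    · intro e he
      rw [List.findSome?_eq_some_iff] at he
      obtain ⟨l₁, p, l₂, hsplit, hpe, hl₁⟩ := he
      have hpl : p ∈ l := by rw [hsplit]; simp
      obtain ⟨hp, hpS⟩ := (hmem p).1 hpl
      have hbefore : ∀ q ∈ T.childPorts dir v, dir.Before q p → T.Closed S X (T.nbr v q) := by
        intro q hq hqp
        by_cases hql : q ∈ l
        · have hirr : ¬ (dir.Before p q ∧ dir.Before q p) := by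
            cases dir <;> simp only [Dir.Before] <;> lia
          have hq₁ : q ∈ l₁ := by
            rw [hsplit, List.mem_append, List.mem_cons] at hql
            rw [hsplit, List.pairwise_append] at hpw
            rcases hql with h1 | rfl | h1
            · exact h1
            · exact absurd ⟨hqp, hqp⟩ hirr
            · exact absurd ⟨List.rel_of_pairwise_cons hpw.2.1 h1, hqp⟩ hirr
          exact hchild q hql (hl₁ q hq₁)
        · exact hnotmem q hq hql
      split_ifs at hpe with hpX
      · obtain ⟨i1, i2, i3, i4, i5, i6⟩ :=
          (ih _ (by rw [T.depth_child hp]; lia) hpS hpX).2 e hpe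
        refine ⟨i1, below_child_subset hp i2, i3, i4, i5, fun a ha p' hp' q hq hqp hy => ?_⟩
        rcases eq_or_mem_below_child dir ha with rfl | ⟨p₂, hp₂, hap⟩
        · obtain rfl := childPort_eq hp' hp hy i2
          exact hbefore q ((T.mem_childPorts_iff _).1 hq) hqp
        · obtain rfl := childPort_eq hp₂ hp
            (mem_below_trans hap (mem_below_trans (child_mem_below hp') hy)) i2
          exact i6 a hap p' hp' q hq hqp hy
      · obtain rfl : (v, T.nbr v p) = e := by simpa using hpe
        refine ⟨hpS, child_mem_below hp, hpX, T.child_ne_root hp,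
          by simp only [T.parent_child hp]; exact hvX, fun a ha p' hp' q hq hqp hy => ?_⟩
        simp only at hy
        rcases eq_or_mem_below_child dir ha with rfl | ⟨p₂, hp₂, hap⟩
        · obtain rfl := childPort_eq hp' hp hy (T.mem_below_self _)
          exact hbefore q ((T.mem_childPorts_iff _).1 hq) hqp
        · exfalso
          have h1 := depth_le_of_mem_below hap
          have h2 := depth_le_of_mem_below hy
          rw [T.depth_child hp, T.depth_child hp'] at h2
          rw [T.depth_child hp₂] at h1
          lia

/-- `find_dfsSeqAux` covers the branchings at vertices below the root of `S`; for the branchings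
above it the side condition is vacuous by `side_root`. -/
theorem extremeUnexplored_spec {S : Subtree V} (hS : T.IsPart S) {X : Set V} (hroot : S.root ∈ X)
    (hne : ¬ S.verts ⊆ X) (dir : Dir) :
    T.extremeUnexplored dir S X ∈ S.verts ∧ T.extremeUnexplored dir S X ∉ X ∧
    T.extremeUnexplored dir S X ≠ T.root ∧ T.nbr (T.extremeUnexplored dir S X) 0 ∈ X ∧
    T.Side dir S X (T.extremeUnexplored dir S X) := by
  have key : ∀ P : V × V → Bool, (∀ e, P e = true ↔ e.2 ∉ X) →
      ∃ e, (((T.dfsSeq dir S).find? P).map Prod.snd).getD S.root = e ∧ e ∈ S.verts ∧ e ∉ X ∧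
        e ≠ T.root ∧ T.nbr e 0 ∈ X ∧ T.Side dir S X e := by
    intro P hP
    obtain ⟨h1, h2⟩ := find_dfsSeqAux hS X dir (Fintype.card V) S.root (by lia) hS.root_mem hroot P hP
    rw [dfsSeq]
    cases hf : (T.dfsSeqAux dir S (Fintype.card V) S.root).find? P with
    | none => exact absurd ((closed_root_iff hS).1 (h1 hf)) hne
    | some e =>
      obtain ⟨i1, i2, i3, i4, i5, i6⟩ := h2 e hf
      refine ⟨e.2, rfl, i1, i3, i4, i5, fun a p hp q hq hqp hy => ?_⟩
      rcases mem_below_or_mem_below hy i2 with h | h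
      · by_cases heq : T.nbr a p = S.root
        · exact side_root hS X dir a p hp q hq hqp (heq ▸ T.mem_below_self _)
        · refine i6 a ?_ p hp q hq hqp hy
          have := parent_mem_below h heq
          rwa [T.parent_child hp] at this
      · exact side_root hS X dir a p hp q hq hqp h
  obtain ⟨e, he, h⟩ : ∃ e, T.extremeUnexplored dir S X = e ∧ e ∈ S.verts ∧ e ∉ X ∧
      e ≠ T.root ∧ T.nbr e 0 ∈ X ∧ T.Side dir S X e := by
    unfold extremeUnexplored
    exact key _ fun e => by simp
  rwa [he]

end PortTree

namespace PortTree

variable {V : Type*} [Fintype V] {T : PortTree V}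

/-! ### The effect of a single search -/

/-- The explored set grows from `X` to `Y` by an agent that searches `S`. -/
structure Advance (T : PortTree V) (B : ℕ) (S : Subtree V) (X Y : Set V) : Prop where
  subset : X ⊆ Y
  subset_union : Y ⊆ X ∪ S.verts
  ancestorClosed : T.AncestorClosed Y
  depth_le : ∀ w ∈ Y, w ∉ X → T.depth w ≤ B

/-- `S'` is a subtree of `S` that contains all unexplored vertices of `S` and is searched from both
sides up to the positions `pos`. -/
structure Refines (T : PortTree V) (S S' : Subtree V) (X : Set V) (pos : Dir → V) : Prop where
  isPart : T.IsPart S'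
  subset : S'.verts ⊆ S.verts
  unexplored_subset : S.verts \ X ⊆ S'.verts
  searched : T.Searched S' X pos

/-- After the root of `S` has been moved down, the search positions are closer to the root; the
moves to explored children are accounted for. -/
theorem SearchState.moveDown {S : Subtree V} (hS : T.IsPart S) {X : Set V}
    (hX : T.AncestorClosed X) {pos : Dir → V} {c : V} {j : ℕ} (h : T.SearchState S X pos c j)
    (hne : ¬ S.verts ⊆ X) :
    ∃ pos', T.Refines S (T.moveDown X S) X pos' ∧ ∀ d, T.depth (pos' d) + T.depth S.root + j ≤
      T.depth (pos d) + T.depth (T.moveDown X S).root := by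
  obtain ⟨i1, i2, i3, pos', i4, i5⟩ := moveDownAux_spec hX (Fintype.card V) hS h.searched
  refine ⟨pos', ⟨i1, i2, i3, i4⟩, fun d => ?_⟩
  have hcX : c ∈ X := hX.mem_of_mem_below (h.searched.pos_explored d) (h.pos_mem_below d)
  have hne' : ¬ (T.moveDown X S).verts ⊆ X := by
    obtain ⟨w, hwS, hwX⟩ := Set.not_subset.1 hne
    exact fun hsub => hwX (hsub (i3 ⟨hwS, hwX⟩))
  have hcb := h.searched.unexplored_subset_below hX hcX h.pos_mem_below
  have hc : T.depth c ≤ T.depth (T.moveDown X S).root :=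
    (stable_moveDown X S).depth_le i1 hX hne' hcX
      fun w hw => hcb ⟨i2 hw.1, hw.2⟩
  have h1 := h.le_depth
  have h2 := depth_le_of_mem_below (h.pos_mem_below d)
  have h3 : T.depth (pos' d) ≤ max (T.depth (pos d)) (T.depth (T.moveDown X S).root) := i5 d
  -- Either the position has not become deeper while the root has sunk by at least `j`, or its
  -- distance from the new root is 0 and the old distance was at least `j`.
  rcases le_max_iff.1 h3 with h4 | h4 <;> lia

theorem Searched.searchState {S : Subtree V} (hS : T.IsPart S) {X : Set V} {pos : Dir → V}
    (h : T.Searched S X pos) : T.SearchState S X pos S.root 0 :=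
  ⟨h, hS.root_mem, fun d => hS.subset_below (h.pos_mem d), by lia⟩

theorem runAgent_of_explored {B : ℕ} {dir : Dir} {S : Subtree V} {u : V} {X : Set V}
    (hX : T.AncestorClosed X) (hu : u ∈ X) :
    T.runAgent B dir S u X = T.dfsLoop dir S (B - T.depth u) u X := by
  rw [runAgent, Set.union_eq_left.2]
  rintro w ⟨hw, -⟩
  exact hX.mem_of_mem_below hu hw

theorem runAgent_of_parent_explored {B : ℕ} {dir : Dir} {S : Subtree V} {u : V} {X : Set V}
    (hX : T.AncestorClosed X) (hu : T.nbr u 0 ∈ X) (hB : T.depth u ≤ B) :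
    T.runAgent B dir S u X = T.dfsLoop dir S (B - T.depth u) u (insert u X) := by
  rw [runAgent]
  congr 1
  ext w
  constructor
  · rintro (hw | ⟨hw, -⟩)
    · exact .inr hw
    · by_cases h : u = w
      · exact .inl h.symm
      · exact .inr (hX.mem_of_mem_below hu (parent_mem_below hw h))
  · rintro (rfl | hw)
    · exact .inr ⟨T.mem_below_self _, hB⟩
    · exact .inl hw

theorem runAgent_of_lt_depth {B : ℕ} {dir : Dir} {S : Subtree V} {u : V} {X : Set V}
    (hX : T.AncestorClosed X) (hu : T.nbr u 0 ∈ X) (hB : B < T.depth u) :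
    T.runAgent B dir S u X = X := by
  rw [runAgent, Nat.sub_eq_zero_of_le hB.le, dfsLoop, Set.union_eq_left.2]
  rintro w ⟨hw, hwB⟩
  refine hX.mem_of_mem_below hu (parent_mem_below hw ?_)
  rintro rfl
  lia

/-- A search that starts at the root of a subtree. -/
theorem runAgent_root {S : Subtree V} (hS : T.IsPart S) {X : Set V} (hX : T.AncestorClosed X)
    {pos : Dir → V} (h : T.Searched S X pos) {B : ℕ} {dir : Dir} (hdir : pos dir = S.root)
    (hB : T.depth S.root ≤ B) :
    T.Advance B S X (T.runAgent B dir S S.root X) ∧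
    (S.verts ⊆ T.runAgent B dir S S.root X ∨ ∃ pos' c j, pos' dir.swap = pos dir.swap ∧
      T.SearchState S (T.runAgent B dir S S.root X) pos' c j ∧ T.depth (pos' dir) ≤ B ∧
      2 * X.ncard + B + T.depth (pos' dir) ≤
        2 * (T.runAgent B dir S S.root X).ncard + 2 * j + 2 * T.depth S.root) := by
  rw [runAgent_of_explored hX (h.root_explored hS hX)]
  have := dfsLoop_spec hS dir B (B - T.depth S.root) X pos S.root 0 hX (h.searchState hS)
    (by rw [hdir]; lia)
  rw [hdir] at this
  obtain ⟨i1, i2, i3, i4, i5⟩ := this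
  refine ⟨⟨i1, i2, i3, i4⟩, i5.imp id ?_⟩
  rintro ⟨pos', c', j', k1, k2, k3, k4⟩
  exact ⟨pos', c', j', k1, k2, k3, by lia⟩

/-- The first unexplored vertex of a stable subtree in the order of a search is at most one level
deeper than the position that the searches in this direction have reached. Moreover, if it is no
child of the root, then both lie below the same child of the root. -/
theorem Searched.extremeUnexplored_position {S : Subtree V} (hS : T.IsPart S) {X : Set V}
    (hX : T.AncestorClosed X) {pos : Dir → V} (h : T.Searched S X pos) (hst : T.Stable S X)
    (hne : ¬ S.verts ⊆ X) (dir : Dir) :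
    T.depth (T.extremeUnexplored dir S X) ≤ T.depth (pos dir) + 1 ∧
    (T.depth S.root + 1 < T.depth (T.extremeUnexplored dir S X) →
      pos dir ∈ T.below (T.nbr (T.extremeUnexplored dir S X) 0)) := by
  obtain ⟨hvS, hvX, hvr, hpX, hside⟩ :=
    extremeUnexplored_spec hS (h.root_explored hS hX) hne dir
  set v := T.extremeUnexplored dir S X
  have hvne : v ≠ S.root := fun hv => hvX (hv ▸ h.root_explored hS hX)
  have hpS := hS.parent_mem v hvS hvne
  have hd := T.depth_parent hvr
  have hvp : v ∈ T.below (T.nbr v 0) := mem_below_of_parent hvr (T.mem_below_self _)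
  have hpo : ¬ T.Closed S X (T.nbr v 0) := fun hc => hvX (hc ⟨hvS, hvp⟩)
  have hroot := depth_le_of_mem_below (hS.subset_below (h.pos_mem dir))
  have key : T.nbr v 0 ≠ S.root → pos dir ∈ T.below (T.nbr v 0) := by
    intro hpr
    -- The parent of `v` is explored and open, so some position lies below it. If only the opposite
    -- position did, then the second open child given by stability would precede `v` in this
    -- direction or precede the opposite position in its own direction; in both cases it would be
    -- closed.
    obtain ⟨d, hdb⟩ := h.open_ancestor _ hpS hpX hpo
    by_contra hcon
    have hds : d = dir.swap := by
      rcases Dir.eq_or_eq_swap dir d with rfl | h1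
      · exact absurd hdb hcon
      · exact h1
    rcases eq_or_mem_below_child .left (hS.subset_below hpS) with h1 | ⟨p, hp, h1⟩
    · exact hpr h1
    have hvb := mem_below_trans h1 hvp
    obtain ⟨q, hq, hqp, hqo⟩ := hst p hp (hX.mem_of_mem_below hpX h1)
      fun hc => hvX (hc ⟨hvS, hvb⟩)
    rcases Dir.before_or_before dir hqp with hb | hb
    · exact hqo (hside _ p hp q hq hb hvb)
    · refine hqo (h.side d _ p hp q hq ?_ (mem_below_trans h1 hdb))
      rw [hds]
      exact Dir.before_swap.2 hb
  constructor
  · by_cases hpr : T.nbr v 0 = S.root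
    · rw [hpr] at hd
      lia
    · have := depth_le_of_mem_below (key hpr)
      lia
  · intro hlt
    refine key fun hpr => ?_
    rw [hpr] at hd
    lia

/-- A search that starts at the first unexplored vertex. -/
theorem runAgent_extremeUnexplored {S : Subtree V} (hS : T.IsPart S) {X : Set V}
    (hX : T.AncestorClosed X) {pos : Dir → V} (h : T.Searched S X pos)
    (hne : ¬ S.verts ⊆ X) {B : ℕ} {dir : Dir} {u : V} (hu : T.extremeUnexplored dir S X = u)
    (hB : T.depth u ≤ B) :
    T.Advance B S X (T.runAgent B dir S u X) ∧
    (S.verts ⊆ T.runAgent B dir S u X ∨ ∃ pos' c j, pos' dir.swap = pos dir.swap ∧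
      T.SearchState S (T.runAgent B dir S u X) pos' c j ∧ T.depth (pos' dir) ≤ B ∧
      2 * X.ncard + 2 + B + T.depth (pos' dir) ≤
        2 * (T.runAgent B dir S u X).ncard + 2 * j + 2 * T.depth u) := by
  obtain ⟨hvS, hvX, hvr, hpX, hside⟩ :=
    extremeUnexplored_spec hS (h.root_explored hS hX) hne dir
  rw [hu] at hvS hvX hvr hpX hside
  rw [runAgent_of_parent_explored hX hpX hB]
  have hsub : X ⊆ insert u X := Set.subset_insert _ _
  have hX' : T.AncestorClosed (insert u X) := by
    rintro w (rfl | hw) hwr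
    · exact .inr hpX
    · exact .inr (hX w hw hwr)
  have h' : T.Searched S (insert u X) (Function.update pos dir u) := by
    refine ⟨fun d => ?_, fun d => ?_, fun d => ?_, fun w hw hwX ho => ?_⟩
    · by_cases hd : d = dir
      · subst hd
        simpa using hvS
      · simpa [hd] using h.pos_mem d
    · by_cases hd : d = dir
      · subst hd
        simp
      · simpa [hd] using .inr (h.pos_explored d)
    · by_cases hd : d = dir
      · subst hd
        simpa using hside.mono hsub
      · simpa [hd] using (h.side d).mono hsub
    · rcases hwX with rfl | hwX
      · exact ⟨dir, by simpa using T.mem_below_self _⟩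
      have ho' : ¬ T.Closed S X w := fun hc => ho (hc.mono hsub)
      obtain ⟨d, hd⟩ := h.open_ancestor w hw hwX ho'
      by_cases hdd : d = dir
      · subst hdd
        refine ⟨d, ?_⟩
        rw [Function.update_self]
        -- If the old position was below `w`, then so is `u`. Were the paths to branch, either `w`
        -- would come before `u` and be closed, or `u` would come before the old position and be
        -- explored.
        rcases T.comparable_or_branch w u with h1 | h1 | ⟨a, p, hp, q, hq, hpq, hwp, huq⟩
        · exact h1
        · exact absurd (hX.mem_of_mem_below hwX h1) hvX
        · exfalso
          rcases Dir.before_or_before d hpq with hb | hb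
          · exact ho' fun x hx => hside a q hq p hp hb huq ⟨hx.1, mem_below_trans hwp hx.2⟩
          · exact hvX (h.side d a p hp q hq hb (mem_below_trans hwp hd) ⟨hvS, huq⟩)
      · exact ⟨d, by simpa [hdd] using hd⟩
  have := dfsLoop_spec hS dir B (B - T.depth u) (insert u X) _ S.root 0 hX' (h'.searchState hS)
    (by rw [Function.update_self]; lia)
  rw [Function.update_self, Function.update_of_ne dir.swap_ne,
    Set.ncard_insert_of_notMem hvX (Set.toFinite _)] at this
  obtain ⟨i1, i2, i3, i4, i5⟩ := this
  refine ⟨⟨hsub.trans i1, i2.trans ?_, i3, fun w hw hwX => ?_⟩, i5.imp id ?_⟩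
  · rintro w ((rfl | hw) | hw)
    · exact .inr hvS
    · exact .inl hw
    · exact .inr hw
  · by_cases hwu : w = u
    · rw [hwu]
      exact hB
    · exact i4 w hw (by rintro (h1 | h1); exacts [hwu h1, hwX h1])
  · rintro ⟨pos', c', j', k1, k2, k3, k4⟩
    exact ⟨pos', c', j', k1, k2, k3, by lia⟩

end PortTree

namespace PortTree

variable {V : Type*} [Fintype V] {T : PortTree V}

/-! ### Amortized number of vertices explored by a search -/

/-- The total distance of the two search positions from the root of the subtree. -/
noncomputable def spread (T : PortTree V) (S : Subtree V) (pos : Dir → V) : ℝ :=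
  ((T.depth (pos .left) : ℝ) - T.depth S.root) + ((T.depth (pos .right) : ℝ) - T.depth S.root)

theorem spread_eq (S : Subtree V) (pos : Dir → V) (dir : Dir) : T.spread S pos =
    ((T.depth (pos dir) : ℝ) - T.depth S.root) +
      ((T.depth (pos dir.swap) : ℝ) - T.depth S.root) := by
  cases dir
  · rfl
  · simp only [spread, Dir.swap]
    ring

theorem spread_nonneg {S : Subtree V} (hS : T.IsPart S) {X : Set V} {pos : Dir → V}
    (h : T.Searched S X pos) : 0 ≤ T.spread S pos := by
  have h1 : ∀ d, (T.depth S.root : ℝ) ≤ T.depth (pos d) := fun d =>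
    Nat.cast_le.2 (depth_le_of_mem_below (hS.subset_below (h.pos_mem d)))
  have := h1 .left
  have := h1 .right
  unfold spread
  linarith

/-- The gain of a vertex that is explored by a search of a subtree whose root has depth `r`. -/
noncomputable def rate (B D r : ℝ) : ℝ := (B - D) / (B - r)

/-- In the degenerate case `r = B` the quotient is 0 by convention; then `D = B` as well and both
sides vanish. -/
theorem rate_mul {B D r : ℝ} (h₁ : r ≤ D) (h₂ : D ≤ B) : rate B D r * (B - r) = B - D := by
  rcases (sub_nonneg.2 (h₁.trans h₂)).eq_or_lt with h | h
  · rw [← h]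
    linarith
  · exact div_mul_cancel₀ _ h.ne'

theorem rate_nonneg {B D r : ℝ} (h₁ : r ≤ D) (h₂ : D ≤ B) : 0 ≤ rate B D r :=
  div_nonneg (by linarith) (by linarith)

theorem rate_le_one {B D r : ℝ} (h₁ : r ≤ D) (h₂ : D ≤ B) : rate B D r ≤ 1 :=
  div_le_one_of_le₀ (by linarith) (by linarith)

/-- `E` is `B` minus the root depth of the subtree, `F` is `B - D`, `n` counts the new vertices and
`j` the moves to explored children. The final distance from the root is `t`, and `s` is one less
than the starting distance. At `g = 1` the factor `3/2` cancels `t`, and `E/2 - 3s/2 ≥ 0` remains to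
be shown, which is where the threshold of one third comes from. Smaller `g` leaves slack. -/
theorem search_inequality {E F g n j s t : ℝ} (hg : g * E = F) (hg₀ : 0 ≤ g) (hg₁ : g ≤ 1)
    (hE : 0 ≤ E) (hs : s ≤ E / 3) (ht : t ≤ E) (hj : 0 ≤ j) (hn : E - 2 * s + t ≤ 2 * n + 2 * j) :
    F + 3 / 2 * (t - s) ≤ (2 + g) * n + 3 * j := by
  have h1 : 0 ≤ g * (E / 3 - s) := mul_nonneg hg₀ (by linarith)
  have h2 : 0 ≤ (1 - g) * (E - t) := mul_nonneg (by linarith) (by linarith)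
  have h3 : 0 ≤ (1 - g) * j := mul_nonneg (by linarith) hj
  have h4 : 0 ≤ (2 + g) * (2 * n + 2 * j - (E - 2 * s + t)) :=
    mul_nonneg (by linarith) (by linarith)
  have h5 : 0 ≤ (1 - g) * E := mul_nonneg (by linarith) hE
  nlinarith

/-- Without a starting distance, the `E/2` that `search_inequality` spends on `s` is left over as a
surplus. -/
theorem root_search_inequality {E F g n j t : ℝ} (hg : g * E = F) (hg₀ : 0 ≤ g) (hg₁ : g ≤ 1)
    (ht : t ≤ E) (hj : 0 ≤ j) (hn : E + t ≤ 2 * n + 2 * j) :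
    F + E / 2 + 3 / 2 * t ≤ (2 + g) * n + 3 * j := by
  have h2 : 0 ≤ (1 - g) * (E - t) := mul_nonneg (by linarith) (by linarith)
  have h3 : 0 ≤ (1 - g) * j := mul_nonneg (by linarith) hj
  have h4 : 0 ≤ (2 + g) * (2 * n + 2 * j - (E + t)) :=
    mul_nonneg (by linarith) (by linarith)
  nlinarith

/-- The outcome of a search of `S` that started at its root, after the root has been moved down. -/
theorem root_search {S : Subtree V} (hS : T.IsPart S) {X : Set V} (hX : T.AncestorClosed X)
    {pos : Dir → V} (h : T.Searched S X pos) {B : ℕ} {dir : Dir} (hdir : pos dir = S.root)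
    (hB : T.depth S.root ≤ B) {Y : Set V} (hY : T.runAgent B dir S S.root X = Y) :
    T.Advance B S X Y ∧
    (S.verts ⊆ Y ∨ ∃ pos', T.Refines S (T.moveDown Y S) Y pos' ∧
      ∀ D : ℝ, T.depth S.root ≤ D → D ≤ B →
        (B - D) + (B - T.depth S.root) / 2 + 3 / 2 * T.spread (T.moveDown Y S) pos' ≤
          (2 + rate B D (T.depth S.root)) * (Y.ncard - X.ncard) +
            3 / 2 * (T.depth (pos dir.swap) - T.depth S.root)) := by
  obtain ⟨hadv, hrun⟩ := runAgent_root hS hX h hdir hB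
  rw [hY] at hadv hrun
  refine ⟨hadv, ?_⟩
  by_cases hfull : S.verts ⊆ Y
  · exact .inl hfull
  obtain hrun | ⟨pos', c, j, hswap, hst, htB, hcount⟩ := hrun
  · exact .inl hrun
  obtain ⟨pos'', href, hpos⟩ := hst.moveDown hS hadv.ancestorClosed hfull
  refine .inr ⟨pos'', href, fun D hD hDB => ?_⟩
  have h1 : ∀ d, (T.depth (pos'' d) : ℝ) + T.depth S.root + j ≤
      T.depth (pos' d) + T.depth (T.moveDown Y S).root := fun d => by exact_mod_cast hpos d
  have h2 : (2 : ℝ) * X.ncard + B + T.depth (pos' dir) ≤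
      2 * Y.ncard + 2 * j + 2 * T.depth S.root := by exact_mod_cast hcount
  have h3 : (T.depth (pos' dir) : ℝ) ≤ B := by exact_mod_cast htB
  have h4 := root_search_inequality (n := (Y.ncard : ℝ) - X.ncard) (j := j)
    (t := (T.depth (pos' dir) : ℝ) - T.depth S.root) (rate_mul hD hDB) (rate_nonneg hD hDB)
    (rate_le_one hD hDB) (by linarith) (by positivity) (by linarith)
  -- Both positions come closer to the lowered root by at least `j`, so `3/2` times the spread drops
  -- by the `3 * j` in `h4`.
  have h5 := h1 dir
  have h6 := h1 dir.swap
  rw [hswap] at h6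
  rw [T.spread_eq _ _ dir]
  linarith

/-- The outcome of a search of `S` that started at the first unexplored vertex, after the root has
been moved down. -/
theorem near_search {S : Subtree V} (hS : T.IsPart S) {X : Set V} (hX : T.AncestorClosed X)
    {pos : Dir → V} (h : T.Searched S X pos) (hst : T.Stable S X) (hne : ¬ S.verts ⊆ X) {B : ℕ}
    {dir : Dir} (hB : T.depth S.root ≤ B) {u : V} (hu : T.extremeUnexplored dir S X = u)
    (hnear : T.Near B S u) {Y : Set V} (hY : T.runAgent B dir S u X = Y) :
    T.Advance B S X Y ∧
    (S.verts ⊆ Y ∨ ∃ pos', T.Refines S (T.moveDown Y S) Y pos' ∧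
      ∀ D : ℝ, T.depth S.root ≤ D → D ≤ B →
        (B - D) + 3 / 2 * T.spread (T.moveDown Y S) pos' ≤
          (2 + rate B D (T.depth S.root)) * (Y.ncard - X.ncard) + 3 / 2 * T.spread S pos) := by
  have hnear' : (T.depth u : ℝ) - T.depth S.root ≤ max 1 (1 / 3 * ((B : ℝ) - T.depth S.root)) := by
    have h1 := (Rat.cast_le (K := ℝ)).2 hnear
    push_cast at h1
    exact h1
  have hBr : (T.depth S.root : ℝ) ≤ B := by exact_mod_cast hB
  -- If the agent cannot reach `u`, then nearness forces the root of `S` to depth at least `B`.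
  -- Hence `B - D` is 0 and there is nothing to pay.
  rcases Nat.lt_or_ge B (T.depth u) with hBu | hBu
  · obtain ⟨hvS, hvX, hvr, hpX, hside⟩ :=
      extremeUnexplored_spec hS (h.root_explored hS hX) hne dir
    rw [hu] at hpX
    rw [runAgent_of_lt_depth hX hpX hBu] at hY
    subst hY
    refine ⟨⟨subset_rfl, Set.subset_union_left, hX, fun w hw hw' => absurd hw hw'⟩, .inr ?_⟩
    rw [moveDown_of_stable hst]
    refine ⟨pos, ⟨hS, subset_rfl, Set.sdiff_subset, h⟩, fun D hD hDB => ?_⟩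
    have hBu' : (B : ℝ) + 1 ≤ T.depth u := by exact_mod_cast hBu
    have : (B : ℝ) ≤ T.depth S.root := by
      rcases le_max_iff.1 hnear' with h1 | h1 <;> linarith
    simp only [sub_self, mul_zero, zero_add]
    linarith
  · obtain ⟨hadv, hrun⟩ := runAgent_extremeUnexplored hS hX h hne hu hBu
    rw [hY] at hadv hrun
    refine ⟨hadv, ?_⟩
    by_cases hfull : S.verts ⊆ Y
    · exact .inl hfull
    obtain hrun | ⟨pos', c, j, hswap, hst', htB, hcount⟩ := hrun
    · exact .inl hrun
    obtain ⟨pos'', href, hpos⟩ := hst'.moveDown hS hadv.ancestorClosed hfull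
    refine .inr ⟨pos'', href, fun D hD hDB => ?_⟩
    have h1 : ∀ d, (T.depth (pos'' d) : ℝ) + T.depth S.root + j ≤
        T.depth (pos' d) + T.depth (T.moveDown Y S).root := fun d => by exact_mod_cast hpos d
    have h2 : (2 : ℝ) * X.ncard + 2 + B + T.depth (pos' dir) ≤
        2 * Y.ncard + 2 * j + 2 * T.depth u := by exact_mod_cast hcount
    have h3 : (T.depth (pos' dir) : ℝ) ≤ B := by exact_mod_cast htB
    have hu' := (h.extremeUnexplored_position hS hX hst hne dir).1
    rw [hu] at hu'
    have h7 : (T.depth u : ℝ) ≤ T.depth (pos dir) + 1 := by exact_mod_cast hu'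
    -- The start is at most one level below the old position and is itself a new vertex: the `2` in
    -- `h2` offsets the `- 1` in `s`. This `- 1` also covers the case in which nearness only says
    -- that the distance is at most 1.
    have h4 := search_inequality (n := (Y.ncard : ℝ) - X.ncard) (j := j)
      (t := (T.depth (pos' dir) : ℝ) - T.depth S.root)
      (s := (T.depth u : ℝ) - 1 - T.depth S.root) (rate_mul hD hDB) (rate_nonneg hD hDB)
      (rate_le_one hD hDB) (by linarith) (by rcases le_max_iff.1 hnear' with h1 | h1 <;> linarith)
      (by linarith) (by positivity) (by linarith)
    have h5 := h1 dir
    have h6 := h1 dir.swap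
    rw [hswap] at h6
    rw [T.spread_eq _ _ dir, T.spread_eq S pos dir]
    linarith

end PortTree

namespace PortTree

variable {V : Type*} [Fintype V] {T : PortTree V}

/-! ### An upper bound for the offline optimum -/

/-- A walk from the root visits all ancestors of the vertices that it visits. -/
theorem mem_support_of_mem_below {u : V} (W : T.graph.Walk T.root u) {a w : V} (hw : w ∈ W.support)
    (h : w ∈ T.below a) : a ∈ W.support := by
  -- For the induction the walk may start anywhere, at the price of the alternative that its start
  -- already lies below `a`. For a start at the root this means that `a` is the root.
  suffices key : ∀ {x y : V} (W : T.graph.Walk x y),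
      ∀ w ∈ W.support, ∀ a, w ∈ T.below a → a ∈ W.support ∨ x ∈ T.below a by
    rcases key W w hw a h with h1 | h1
    · exact h1
    · have : a = T.root := by
        by_contra hne
        exact ne_root_of_mem_below h1 (Ne.symm hne) rfl
      rw [this]
      exact W.start_mem_support
  intro x y W
  induction W with
  | nil =>
    intro w hw a h
    simp only [SimpleGraph.Walk.support_nil, List.mem_singleton] at hw
    exact .inr (hw ▸ h)
  | @cons x z y hadj W ih =>
    intro w hw a h
    rw [SimpleGraph.Walk.support_cons, List.mem_cons] at hw
    rcases hw with rfl | hw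
    · exact .inr h
    rcases ih w hw a h with h1 | h1
    · exact .inl (by simp [h1])
    · rcases T.depth_adj hadj with hd | hd
      · right
        have hx : x ≠ T.root := by
          rintro rfl
          simp [depth_root] at hd
        rw [T.eq_parent hadj (by lia)] at h1
        exact mem_below_of_parent hx h1
      · by_cases hza : z = a
        · left
          rw [SimpleGraph.Walk.support_cons, ← hza]
          exact List.mem_cons_of_mem _ W.start_mem_support
        · right
          rw [T.eq_parent hadj.symm (by lia)]
          exact parent_mem_below h1 hza

theorem sum_le_of_eq_zero_of_le {ι : Type*} [DecidableEq ι] {s t : Finset ι} {f : ι → ℝ} {m : ℝ}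
    (ht : t ⊆ s) (h₀ : ∀ i ∈ t, f i = 0) (hm : ∀ i ∈ s, f i ≤ m) :
    ∑ i ∈ s, f i ≤ (s.card - t.card) * m := by
  rw [← Finset.sum_sdiff ht, Finset.sum_eq_zero h₀, add_zero]
  calc ∑ i ∈ s \ t, f i ≤ (s \ t).card • m :=
        Finset.sum_le_card_nsmul _ _ _ fun i hi => hm i (Finset.mem_sdiff.1 hi).1
    _ = (s.card - t.card) * m := by
        rw [nsmul_eq_mul, Finset.card_sdiff_of_subset ht, Nat.cast_sub (Finset.card_le_card ht)]

theorem sum_biUnion_le_sum_sum {ι κ : Type*} [DecidableEq ι] (s : Finset κ) (U : κ → Finset ι)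
    {f : ι → ℝ} (hf : ∀ i, 0 ≤ f i) : ∑ i ∈ s.biUnion U, f i ≤ ∑ k ∈ s, ∑ i ∈ U k, f i := by
  classical
  induction s using Finset.induction_on with
  | empty => simp
  | insert k s hk ih =>
    rw [Finset.biUnion_insert, Finset.sum_insert hk]
    have := Finset.sum_union_inter (s₁ := U k) (s₂ := s.biUnion U) (f := f)
    have h0 : 0 ≤ ∑ i ∈ U k ∩ s.biUnion U, f i := Finset.sum_nonneg fun i _ => hf i
    linarith

/-- The gains `g` of the explored vertices are such that a walk of length at most `B` from the root
cannot collect more than `B - D` in total, where every unexplored vertex has gain `1`. -/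
structure IsGain (T : PortTree V) (B D : ℕ) (X : Set V) (g : V → ℝ) : Prop where
  nonneg : ∀ v, 0 ≤ g v
  le_one : ∀ v, g v ≤ 1
  explored : ∀ v ∈ X, 0 < g v → ∃ r ≤ T.depth v, g v * ((B : ℝ) - r) ≤ (B : ℝ) - D ∧
    ∀ a, v ∈ T.below a → T.depth a ≤ r → g a = 0

open Classical in
/-- The total weight of the explored vertices. -/
noncomputable def weight (X : Set V) (g : V → ℝ) : ℝ := ∑ v ∈ X.toFinset, (2 + g v)

/-- Over the visited vertices, split 1 into `f` and `1 - f`. The walks bound the sum of `f`, whereas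
`1 - f` vanishes outside `X`, so its sum is at most that of `1 - g` over `X`. -/
theorem opt_le_of_isGain {B D k : ℕ} {X : Set V} {g : V → ℝ} (hg : T.IsGain B D X g) (hD : D ≤ B)
    (hX : T.AncestorClosed X)
    (hunexp : ∀ w ∉ X, D ≤ T.depth w ∧ ∀ a, w ∈ T.below a → T.depth a ≤ D → a ∈ X ∧ g a = 0)
    (hw : k * ((B : ℝ) - D) ≤ weight X g) : T.opt k B ≤ 3 * X.ncard := by
  classical
  obtain ⟨e, W, hW, hcard⟩ := (T.isGreatest_opt k B).1
  let f : V → ℝ := fun v => if v ∈ X then g v else 1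
  have hf₀ : ∀ v, 0 ≤ f v := fun v => by
    simp only [f]
    split_ifs
    exacts [hg.nonneg v, zero_le_one]
  have hf₁ : ∀ v, f v ≤ 1 := fun v => by
    simp only [f]
    split_ifs
    exacts [hg.le_one v, le_rfl]
  have hDB : (D : ℝ) ≤ B := by exact_mod_cast hD
  have hanc : ∀ (i : Fin k) (w : V) (r : ℕ), w ∈ (W i).support → r ≤ T.depth w →
      {a | w ∈ T.below a ∧ T.depth a ≤ r}.toFinset ⊆ (W i).support.toFinset ∧
      ({a | w ∈ T.below a ∧ T.depth a ≤ r}.toFinset.card : ℝ) = r + 1 := by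
    intro i w r hwi hr
    refine ⟨fun a ha => ?_, ?_⟩
    · rw [Set.mem_toFinset] at ha
      exact List.mem_toFinset.2 (mem_support_of_mem_below (W i) hwi ha.1)
    · rw [← Set.ncard_eq_toFinset_card', T.ncard_ancestors w hr]
      push_cast
      ring
  have hlen : ∀ i, ((W i).support.toFinset.card : ℝ) ≤ B + 1 := by
    intro i
    have h1 := List.toFinset_card_le (W i).support
    rw [SimpleGraph.Walk.length_support] at h1
    exact_mod_cast h1.trans (Nat.add_le_add_right (hW i) 1)
  have hwalk : ∀ i, ∑ v ∈ (W i).support.toFinset, f v ≤ (B : ℝ) - D := by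
    intro i
    have hl := hlen i
    -- Inside `X`, a vertex of maximal positive gain comes with `r + 1` ancestors of gain 0, and at
    -- most `B - r` vertices of at most its gain remain. Outside `X`, an unexplored vertex comes
    -- with `D + 1` ancestors of gain 0.
    by_cases hsub : ∀ w ∈ (W i).support, w ∈ X
    · obtain ⟨v, hv, hmax⟩ := Finset.exists_max_image (W i).support.toFinset f
        ⟨T.root, List.mem_toFinset.2 (W i).start_mem_support⟩
      rw [List.mem_toFinset] at hv
      have hfv : f v = g v := if_pos (hsub v hv)
      rcases (hf₀ v).eq_or_lt with h0 | h0
      · have := Finset.sum_nonpos fun x hx => (hmax x hx).trans h0.ge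
        linarith
      obtain ⟨r, hr, hgr, hzero⟩ := hg.explored v (hsub v hv) (hfv ▸ h0)
      obtain ⟨h1, h2⟩ := hanc i v r hv hr
      have h3 := sum_le_of_eq_zero_of_le h1 (fun a ha => by
        rw [Set.mem_toFinset] at ha
        have haX := hX.mem_of_mem_below (hsub v hv) ha.1
        simp only [f, if_pos haX]
        exact hzero a ha.1 ha.2) hmax
      rw [h2] at h3
      have h4 : ((W i).support.toFinset.card - ((r : ℝ) + 1)) * f v ≤ ((B : ℝ) - r) * f v :=
        mul_le_mul_of_nonneg_right (by linarith) h0.le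
      rw [hfv] at h3 h4
      linarith
    · push Not at hsub
      obtain ⟨w, hwi, hwX⟩ := hsub
      obtain ⟨hDw, hzero⟩ := hunexp w hwX
      obtain ⟨h1, h2⟩ := hanc i w D hwi hDw
      have h3 := sum_le_of_eq_zero_of_le h1 (fun a ha => by
        rw [Set.mem_toFinset] at ha
        obtain ⟨haX, ha0⟩ := hzero a ha.1 ha.2
        simp only [f, if_pos haX]
        exact ha0) (fun v _ => hf₁ v)
      rw [h2] at h3
      linarith
  let U : Finset V := Finset.univ.biUnion fun i => (W i).support.toFinset
  have hU : (T.opt k B : ℝ) = U.card := by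
    rw [← hcard, Set.ncard_eq_toFinset_card']
    congr 2
    ext w
    simp [U]
  have h1 : ∑ v ∈ U, f v ≤ k * ((B : ℝ) - D) := by
    refine (sum_biUnion_le_sum_sum _ _ hf₀).trans ?_
    refine (Finset.sum_le_card_nsmul _ _ _ fun i _ => hwalk i).trans ?_
    simp
  have h2 : ∑ v ∈ U, (1 - f v) ≤ ∑ v ∈ X.toFinset, (1 - g v) := by
    calc ∑ v ∈ U, (1 - f v) ≤ ∑ v, (1 - f v) :=
          Finset.sum_le_sum_of_subset_of_nonneg (Finset.subset_univ _)
            fun v _ _ => sub_nonneg.2 (hf₁ v)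
      _ = ∑ v ∈ X.toFinset, (1 - f v) := by
          symm
          refine Finset.sum_subset (Finset.subset_univ _) fun v _ hv => ?_
          rw [Set.mem_toFinset] at hv
          simp [f, hv]
      _ = ∑ v ∈ X.toFinset, (1 - g v) := by
          refine Finset.sum_congr rfl fun v hv => ?_
          rw [Set.mem_toFinset] at hv
          simp [f, hv]
  have h3 : (U.card : ℝ) = ∑ v ∈ U, f v + ∑ v ∈ U, (1 - f v) := by
    rw [← Finset.sum_add_distrib]
    simp
  have h4 : ∑ v ∈ X.toFinset, (1 - g v) + weight X g = 3 * (X.ncard : ℝ) := by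
    rw [weight, ← Finset.sum_add_distrib, Set.ncard_eq_toFinset_card', mul_comm,
      ← nsmul_eq_mul, ← Finset.sum_const]
    exact Finset.sum_congr rfl fun v _ => by ring
  have : (T.opt k B : ℝ) ≤ 3 * X.ncard := by
    rw [hU]
    linarith
  exact_mod_cast this

end PortTree

namespace PortTree

variable {V : Type*} [Fintype V] {T : PortTree V}

/-! ### The invariant of the outer loop -/

/-- The members of `F` with unexplored vertices are the subtrees listed in `A`, together with the
positions that the searches have reached in them; they share at most their roots and contain all
unexplored vertices. -/
structure Forest (T : PortTree V) (B : ℕ) (X : Set V) (F : Set (Subtree V))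
    (A : Finset (Subtree V × (Dir → V))) : Prop where
  ancestorClosed : T.AncestorClosed X
  depth_le : ∀ w ∈ X, T.depth w ≤ B
  isPart : ∀ i ∈ A, T.IsPart i.1
  searched : ∀ i ∈ A, T.Searched i.1 X i.2
  not_subset : ∀ i ∈ A, ¬ i.1.verts ⊆ X
  disjoint : ∀ i ∈ A, ∀ i' ∈ A, i ≠ i' → Disjoint (i.1.verts \ {i.1.root}) i'.1.verts
  cover : ∀ w ∉ X, ∃ i ∈ A, w ∈ i.1.verts
  mem_family : ∀ i ∈ A, i.1 ∈ F
  of_mem_family : ∀ S ∈ F, ¬ S.verts ⊆ X → ∃ pos, (S, pos) ∈ A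

/-- The potential of a subtree with unexplored vertices. -/
noncomputable def potential (T : PortTree V) (B D : ℕ) (i : Subtree V × (Dir → V)) : ℝ :=
  (B : ℝ) - min (T.depth i.1.root : ℝ) (D : ℝ) + 3 / 2 * T.spread i.1 i.2

/-- The explored vertices pay for `m` agents and for the potentials of the subtrees in `A`, up to a
deficit of `c`. -/
structure Account (T : PortTree V) (B D : ℕ) (X : Set V) (A : Finset (Subtree V × (Dir → V)))
    (m : ℕ) (c : ℝ) (g : V → ℝ) : Prop where
  isGain : T.IsGain B D X g
  gain_eq_zero : ∀ i ∈ A, ∀ a, i.1.root ∈ T.below a → T.depth a ≤ D → g a = 0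
  le_weight : m * ((B : ℝ) - D) + ∑ i ∈ A, T.potential B D i ≤ weight X g + c

/-! ### Independence of the subtrees of the forest -/

theorem Searched.congr {S : Subtree V} {X Y : Set V} {pos : Dir → V} (h : T.Searched S X pos)
    (hXY : X ⊆ Y) (hagree : ∀ w ∈ S.verts, w ∈ Y → w ∈ X) : T.Searched S Y pos where
  pos_mem := h.pos_mem
  pos_explored := fun d => hXY (h.pos_explored d)
  side := fun d => (h.side d).mono hXY
  open_ancestor := fun u hu huY ho =>
    h.open_ancestor u hu (hagree u hu huY) fun hc => ho (hc.mono hXY)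

/-- The effect of moving down the root of `S` depends only on the explored vertices in `S`. -/
theorem moveDownAux_congr {S : Subtree V} (hS : T.IsPart S) {X Y : Set V}
    (hXY : ∀ w ∈ S.verts, w ∈ X ↔ w ∈ Y) (n : ℕ) : T.moveDownAux X n S = T.moveDownAux Y n S := by
  induction n generalizing S with
  | zero => rfl
  | succ n ih =>
    by_cases hst : T.Stable S X
    · rw [moveDownAux_of_stable hst, moveDownAux_of_stable (hst.congr hS hXY)]
    · obtain ⟨p, hp, hpX, hpo, hq, hm⟩ := moveDownAux_of_not_stable hst
      obtain ⟨p', hp', hpX', hpo', hq', hm'⟩ := moveDownAux_of_not_stable (X := Y)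
        fun hst' => hst (hst'.congr hS fun w hw => (hXY w hw).symm)
      have hpp : p' = p := hq p' hp' fun hc => hpo' fun w hw => (hXY w hw.1).1 (hc hw)
      subst hpp
      rw [hm, hm']
      have hmem := hS.child_mem hS.root_mem hp hpo
      have hne : T.nbr S.root p' ≠ S.root := by
        intro h
        have := T.depth_child hp
        rw [h] at this
        lia
      exact ih (isPart_below _) fun w hw => hXY w (hS.below_subset _ hmem hne hw)

theorem moveDown_congr {S : Subtree V} (hS : T.IsPart S) {X Y : Set V}
    (hXY : ∀ w ∈ S.verts, w ∈ X ↔ w ∈ Y) : T.moveDown X S = T.moveDown Y S :=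
  moveDownAux_congr hS hXY _

/-- If the root of the larger part belongs to the smaller one, it has least depth there and is its
root too. Disjointness up to roots therefore passes to smaller parts. -/
theorem IsPart.diff_root_subset {S S' : Subtree V} (hS' : T.IsPart S') (hS : T.IsPart S)
    (h : S'.verts ⊆ S.verts) : S'.verts \ {S'.root} ⊆ S.verts \ {S.root} := by
  rintro w ⟨hw, hwr⟩
  refine ⟨h hw, ?_⟩
  rintro rfl
  exact hwr (eq_of_mem_below_of_depth_le (hS'.subset_below hw)
    (depth_le_of_mem_below (hS.subset_below (h hS'.root_mem))))

theorem potential_nonneg {B D : ℕ} (hD : D ≤ B) {i : Subtree V × (Dir → V)} (hi : T.IsPart i.1)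
    {X : Set V} (h : T.Searched i.1 X i.2) : 0 ≤ T.potential B D i := by
  have h1 := spread_nonneg hi h
  have h2 : (D : ℝ) ≤ B := by exact_mod_cast hD
  have h3 : min (T.depth i.1.root : ℝ) D ≤ D := min_le_right _ _
  unfold potential
  linarith

theorem Forest.root_explored {B : ℕ} {X : Set V} {F : Set (Subtree V)}
    {A : Finset (Subtree V × (Dir → V))} (h : T.Forest B X F A) {i : Subtree V × (Dir → V)}
    (hi : i ∈ A) : i.1.root ∈ X :=
  (h.searched i hi).root_explored (h.isPart i hi) h.ancestorClosed

/-- A search of one subtree does not affect the other subtrees. -/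
theorem Forest.mem_of_mem {B : ℕ} {X : Set V} {F : Set (Subtree V)}
    {A : Finset (Subtree V × (Dir → V))} (h : T.Forest B X F A) {i i' : Subtree V × (Dir → V)}
    (hi : i ∈ A) (hi' : i' ∈ A) (hne : i ≠ i') {Y : Set V} (hY : Y ⊆ X ∪ i.1.verts) {w : V}
    (hw : w ∈ i'.1.verts) (hwY : w ∈ Y) : w ∈ X := by
  rcases hY hwY with hwX | hwi
  · exact hwX
  · by_cases hwr : w = i.1.root
    · rw [hwr]
      exact h.root_explored hi
    · exact absurd hw (Set.disjoint_left.1 (h.disjoint i hi i' hi' hne) ⟨hwi, hwr⟩)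

theorem Forest.stable {B : ℕ} {X : Set V} {F : Set (Subtree V)}
    {A : Finset (Subtree V × (Dir → V))} (h : T.Forest B X F A) {i i' : Subtree V × (Dir → V)}
    (hi : i ∈ A) (hi' : i' ∈ A) (hne : i ≠ i') {Y : Set V} (hXY : X ⊆ Y) (hY : Y ⊆ X ∪ i.1.verts)
    (hst : T.Stable i'.1 X) : T.Stable i'.1 Y :=
  hst.congr (h.isPart i' hi') fun _ hw => ⟨fun hwX => hXY hwX, h.mem_of_mem hi hi' hne hY hw⟩

open Classical in
/-- Replacing one subtree of the forest by subtrees that contain its unexplored vertices. -/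
theorem Forest.replace {B : ℕ} {X : Set V} {F : Set (Subtree V)}
    {A : Finset (Subtree V × (Dir → V))} (h : T.Forest B X F A) {i : Subtree V × (Dir → V)}
    (hi : i ∈ A) {Y : Set V} (hadv : T.Advance B i.1 X Y) {N : Finset (Subtree V × (Dir → V))}
    {G : Set (Subtree V)} (hpart : ∀ n ∈ N, T.IsPart n.1)
    (hsub : ∀ n ∈ N, n.1.verts ⊆ i.1.verts)
    (hsearched : ∀ n ∈ N, T.Searched n.1 Y n.2) (hopen : ∀ n ∈ N, ¬ n.1.verts ⊆ Y)
    (hdisj : ∀ n ∈ N, ∀ n' ∈ N, n ≠ n' → Disjoint (n.1.verts \ {n.1.root}) n'.1.verts)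
    (hcover : ∀ w ∈ i.1.verts, w ∉ Y → ∃ n ∈ N, w ∈ n.1.verts) (hNG : ∀ n ∈ N, n.1 ∈ G)
    (hAG : ∀ i' ∈ A, i' ≠ i → i'.1 ∈ G)
    (hG : ∀ S ∈ G, ¬ S.verts ⊆ Y → ∃ pos, (S, pos) ∈ A.erase i ∪ N) :
    T.Forest B Y G (A.erase i ∪ N) := by
  have hsplit : ∀ {n}, n ∈ A.erase i ∪ N ↔ (n ≠ i ∧ n ∈ A) ∨ n ∈ N := by
    intro n
    rw [Finset.mem_union, Finset.mem_erase]
  have hsub' : ∀ n ∈ N, n.1.verts \ {n.1.root} ⊆ i.1.verts \ {i.1.root} := fun n hn =>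
    (hpart n hn).diff_root_subset (h.isPart i hi) (hsub n hn)
  refine ⟨hadv.ancestorClosed, fun w hw => ?_, fun n hn => ?_, fun n hn => ?_, fun n hn => ?_,
    fun n hn n' hn' hne => ?_, fun w hw => ?_, fun n hn => ?_, hG⟩
  · by_cases hwX : w ∈ X
    · exact h.depth_le w hwX
    · exact hadv.depth_le w hw hwX
  · rcases hsplit.1 hn with ⟨-, hn⟩ | hn
    exacts [h.isPart n hn, hpart n hn]
  · rcases hsplit.1 hn with ⟨hni, hn⟩ | hn
    · exact (h.searched n hn).congr hadv.subset fun w hw hwY =>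
        h.mem_of_mem hi hn hni.symm hadv.subset_union hw hwY
    · exact hsearched n hn
  · rcases hsplit.1 hn with ⟨hni, hn⟩ | hn
    · exact fun hc => h.not_subset n hn fun w hw =>
        h.mem_of_mem hi hn hni.symm hadv.subset_union hw (hc hw)
    · exact hopen n hn
  · rcases hsplit.1 hn with ⟨hni, hn⟩ | hn <;> rcases hsplit.1 hn' with ⟨hni', hn'⟩ | hn'
    · exact h.disjoint n hn n' hn' hne
    · exact (h.disjoint n hn i hi hni).mono_right (hsub n' hn')
    · exact (h.disjoint i hi n' hn' hni'.symm).mono_left (hsub' n hn)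
    · exact hdisj n hn n' hn' hne
  · obtain ⟨n, hn, hwn⟩ := h.cover w fun hwX => hw (hadv.subset hwX)
    by_cases hni : n = i
    · subst hni
      obtain ⟨n', hn', hwn'⟩ := hcover w hwn hw
      exact ⟨n', hsplit.2 (.inr hn'), hwn'⟩
    · exact ⟨n, hsplit.2 (.inl ⟨hni, hn⟩), hwn⟩
  · rcases hsplit.1 hn with ⟨hni, hn⟩ | hn
    exacts [hAG n hn hni, hNG n hn]

/-! ### Updating the gains -/

theorem weight_eq_sub {Y : Set V} {Z : Finset V} [DecidableEq V] (g : V → ℝ) (h₀ : ∀ v, 0 ≤ g v) :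
    weight Y g - ∑ v ∈ Z, g v ≤ weight Y fun v => if v ∈ Z then 0 else g v := by
  classical
  unfold weight
  have h1 : ∑ v ∈ Y.toFinset, (2 + g v) - ∑ v ∈ Y.toFinset, (2 + if v ∈ Z then 0 else g v) =
      ∑ v ∈ Y.toFinset, if v ∈ Z then g v else 0 := by
    rw [← Finset.sum_sub_distrib]
    refine Finset.sum_congr rfl fun v _ => ?_
    split_ifs <;> ring
  have h2 : (∑ v ∈ Y.toFinset, if v ∈ Z then g v else 0) ≤ ∑ v ∈ Z, g v := by
    rw [← Finset.sum_filter]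
    exact Finset.sum_le_sum_of_subset_of_nonneg (fun v hv => (Finset.mem_filter.1 hv).2)
      fun v _ _ => h₀ v
  linarith

theorem weight_extend {X Y : Set V} (hXY : X ⊆ Y) (g g' : V → ℝ) (r : ℝ) (h₁ : ∀ v ∈ X, g' v = g v)
    (h₂ : ∀ v ∉ X, g' v = r) :
    weight Y g' = weight X g + (2 + r) * ((Y.ncard : ℝ) - X.ncard) := by
  classical
  unfold weight
  have hsub : X.toFinset ⊆ Y.toFinset := Set.toFinset_subset_toFinset.2 hXY
  rw [← Finset.sum_sdiff hsub, add_comm]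
  congr 1
  · exact Finset.sum_congr rfl fun v hv => by rw [h₁ v (Set.mem_toFinset.1 hv)]
  · rw [Finset.sum_congr rfl fun v hv => by
      rw [h₂ v fun hvX => (Finset.mem_sdiff.1 hv).2 (Set.mem_toFinset.2 hvX)],
      Finset.sum_const, Finset.card_sdiff_of_subset hsub, nsmul_eq_mul,
      Nat.cast_sub (Finset.card_le_card hsub), Set.ncard_eq_toFinset_card',
      Set.ncard_eq_toFinset_card']
    ring

open Classical in
/-- The accounting for the replacement of one subtree of the forest. -/
theorem Account.replace {B D : ℕ} (hD : D ≤ B) {X : Set V} {F : Set (Subtree V)}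
    {A : Finset (Subtree V × (Dir → V))} (h : T.Forest B X F A) {m m' : ℕ} {c c' : ℝ} {g : V → ℝ}
    (hacc : T.Account B D X A m c g) {i : Subtree V × (Dir → V)}
    (hi : i ∈ A) (hiD : T.depth i.1.root ≤ D) {Y : Set V} (hadv : T.Advance B i.1 X Y)
    {N : Finset (Subtree V × (Dir → V))} (hpart : ∀ n ∈ N, T.IsPart n.1)
    (hsub : ∀ n ∈ N, n.1.verts ⊆ i.1.verts) (hsearched : ∀ n ∈ N, T.Searched n.1 Y n.2)
    (hpay : m' * ((B : ℝ) - D) +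
      ∑ n ∈ N, ((B : ℝ) - T.depth i.1.root + 3 / 2 * T.spread n.1 n.2) + c ≤
      (2 + rate B D (T.depth i.1.root)) * ((Y.ncard : ℝ) - X.ncard) +
        ((B : ℝ) - T.depth i.1.root + 3 / 2 * T.spread i.1 i.2) + c') :
    ∃ g', T.Account B D Y (A.erase i ∪ N) (m + m') c' g' ∧ ∀ a ∈ X, g a = 0 → g' a = 0 := by
  have hiD' : (T.depth i.1.root : ℝ) ≤ D := by exact_mod_cast hiD
  have hD' : (D : ℝ) ≤ B := by exact_mod_cast hD
  have hX := h.ancestorClosed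
  set ρ := T.depth i.1.root with hρ
  -- The gains are updated in two stages: `g₁` gives the new vertices the rate for root depth `ρ`,
  -- and then `g'` resets the set `Z` of ancestors of new roots down to depth `D`.
  let g₁ : V → ℝ := fun v => if v ∈ X then g v else rate B D ρ
  have hg₁X : ∀ v ∈ X, g₁ v = g v := fun v hv => if_pos hv
  have hg₁X' : ∀ v ∉ X, g₁ v = rate B D ρ := fun v hv => if_neg hv
  have hg₁0 : ∀ v, 0 ≤ g₁ v := by
    intro v
    by_cases hv : v ∈ X
    · rw [hg₁X v hv]
      exact hacc.isGain.nonneg v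
    · rw [hg₁X' v hv]
      exact rate_nonneg hiD' hD'
  have hg₁1 : ∀ v, g₁ v ≤ 1 := by
    intro v
    by_cases hv : v ∈ X
    · rw [hg₁X v hv]
      exact hacc.isGain.le_one v
    · rw [hg₁X' v hv]
      exact rate_le_one hiD' hD'
  let Zn : Subtree V × (Dir → V) → Finset V := fun n =>
    {a | n.1.root ∈ T.below a ∧ T.depth a ≤ min (T.depth n.1.root) D}.toFinset
  let Z : Finset V := N.biUnion Zn
  let g' : V → ℝ := fun v => if v ∈ Z then 0 else g₁ v
  have hg'Z : ∀ v ∈ Z, g' v = 0 := fun v hv => if_pos hv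
  have hg'1 : ∀ v ∉ Z, g' v = g₁ v := fun v hv => if_neg hv
  have hzero : ∀ a ∈ X, g a = 0 → g' a = 0 := by
    intro a ha h0
    by_cases haZ : a ∈ Z
    · exact hg'Z a haZ
    · rw [hg'1 a haZ, hg₁X a ha, h0]
  have hanc : ∀ w a, w ∈ i.1.verts → w ∈ T.below a → T.depth a ≤ ρ → a ∈ X ∧ g a = 0 := by
    intro w a hw ha had
    have hia := mem_below_of_depth_le ha ((h.isPart i hi).subset_below hw) had
    exact ⟨hX.mem_of_mem_below (h.root_explored hi) hia,
      hacc.gain_eq_zero i hi a hia (had.trans hiD)⟩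
  refine ⟨g', ⟨⟨fun v => ?_, fun v => ?_, fun v hv hpos => ?_⟩, fun n hn a ha had => ?_, ?_⟩, hzero⟩
  · by_cases hv : v ∈ Z
    · rw [hg'Z v hv]
    · rw [hg'1 v hv]
      exact hg₁0 v
  · by_cases hv : v ∈ Z
    · rw [hg'Z v hv]
      exact zero_le_one
    · rw [hg'1 v hv]
      exact hg₁1 v
  · have hvZ : v ∉ Z := fun hvZ => hpos.ne' (hg'Z v hvZ)
    rw [hg'1 v hvZ] at hpos ⊢
    by_cases hvX : v ∈ X
    · rw [hg₁X v hvX] at hpos ⊢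
      obtain ⟨r, hr, hgr, ha⟩ := hacc.isGain.explored v hvX hpos
      exact ⟨r, hr, hgr, fun a hva had => hzero a (hX.mem_of_mem_below hvX hva) (ha a hva had)⟩
    · rw [hg₁X' v hvX]
      have hvi : v ∈ i.1.verts := (hadv.subset_union hv).resolve_left hvX
      refine ⟨ρ, depth_le_of_mem_below ((h.isPart i hi).subset_below hvi),
        (rate_mul hiD' hD').le, fun a hva had => ?_⟩
      obtain ⟨h1, h2⟩ := hanc v a hvi hva had
      exact hzero a h1 h2
  · rw [Finset.mem_union, Finset.mem_erase] at hn
    rcases hn with ⟨-, hn⟩ | hn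
    · exact hzero a (hX.mem_of_mem_below (h.root_explored hn) ha) (hacc.gain_eq_zero n hn a ha had)
    · refine hg'Z a (Finset.mem_biUnion.2 ⟨n, hn, Set.mem_toFinset.2 ⟨ha, ?_⟩⟩)
      exact le_min (depth_le_of_mem_below ha) had
  · have hw1 : weight Y g₁ - ∑ v ∈ Z, g₁ v ≤ weight Y g' := weight_eq_sub g₁ hg₁0
    have hw2 := weight_extend hadv.subset g g₁ _ hg₁X hg₁X'
    -- Ancestors of depth at most `ρ` already have gain 0, so for each new root only the levels from
    -- `ρ + 1` to the minimum can lose, at most 1 each.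
    have hw3 : ∑ v ∈ Z, g₁ v ≤ ∑ n ∈ N, (min (T.depth n.1.root : ℝ) D - ρ) := by
      refine (sum_biUnion_le_sum_sum N Zn hg₁0).trans (Finset.sum_le_sum fun n hn => ?_)
      have hroot : n.1.root ∈ i.1.verts := hsub n hn (hpart n hn).root_mem
      have hρn : ρ ≤ T.depth n.1.root :=
        depth_le_of_mem_below ((h.isPart i hi).subset_below hroot)
      have hsubset : {a | n.1.root ∈ T.below a ∧ T.depth a ≤ ρ}.toFinset ⊆ Zn n := by
        intro a ha
        rw [Set.mem_toFinset] at ha ⊢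
        exact ⟨ha.1, ha.2.trans (le_min hρn hiD)⟩
      have := sum_le_of_eq_zero_of_le (f := g₁) hsubset (fun a ha => by
        rw [Set.mem_toFinset] at ha
        obtain ⟨h1, h2⟩ := hanc _ a hroot ha.1 ha.2
        rw [hg₁X a h1, h2]) (fun a _ => hg₁1 a)
      have hc1 : (Zn n).card = min (T.depth n.1.root) D + 1 := by
        rw [← T.ncard_ancestors n.1.root (min_le_left _ D), Set.ncard_eq_toFinset_card']
      have hc2 : {a | n.1.root ∈ T.below a ∧ T.depth a ≤ ρ}.toFinset.card = ρ + 1 := by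
        rw [← T.ncard_ancestors n.1.root hρn, Set.ncard_eq_toFinset_card']
      rw [hc1, hc2] at this
      push_cast at this
      linarith
    have hs1 : ∑ n ∈ A.erase i ∪ N, T.potential B D n ≤
        ∑ n ∈ A.erase i, T.potential B D n + ∑ n ∈ N, T.potential B D n := by
      rw [← Finset.sum_union_inter]
      refine le_add_of_nonneg_right (Finset.sum_nonneg fun n hn => ?_)
      have hnN := (Finset.mem_inter.1 hn).2
      exact potential_nonneg hD (hpart n hnN) (hsearched n hnN)
    have hs2 := Finset.add_sum_erase A (T.potential B D) hi
    have hs3 : T.potential B D i = (B : ℝ) - ρ + 3 / 2 * T.spread i.1 i.2 := by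
      unfold potential
      rw [min_eq_left hiD']
    -- The reset costs what the lower root removes from the potential; this is why `hpay` contains
    -- `ρ` instead of the new root depths.
    have hs4 : ∑ n ∈ N, T.potential B D n + ∑ n ∈ N, (min (T.depth n.1.root : ℝ) D - ρ) =
        ∑ n ∈ N, ((B : ℝ) - ρ + 3 / 2 * T.spread n.1 n.2) := by
      rw [← Finset.sum_add_distrib]
      refine Finset.sum_congr rfl fun n _ => ?_
      unfold potential
      ring
    have hle := hacc.le_weight
    push_cast
    linarith

/-- The state of the algorithm after `m` agents have been used, if `F` is the family of subtrees. -/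
def Invariant (T : PortTree V) (B m : ℕ) (X : Set V) (F : Set (Subtree V)) : Prop :=
  ∃ A, T.Forest B X F A ∧ ∀ D ≤ B, (∃ i ∈ A, T.depth i.1.root ≤ D) →
    ∃ g, T.Account B D X A m 0 g

/-- The bound for the number of explored vertices when all agents have been used. -/
theorem opt_le_of_account {B D m : ℕ} (hD : D ≤ B) {X Y : Set V} {F : Set (Subtree V)}
    {A : Finset (Subtree V × (Dir → V))} (h : T.Forest B X F A) (hXY : X ⊆ Y)
    (hY : T.AncestorClosed Y) (hmin : ∀ i ∈ A, D ≤ T.depth i.1.root) {g : V → ℝ}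
    (hg : T.IsGain B D Y g)
    (hzero : ∀ i ∈ A, ∀ a, i.1.root ∈ T.below a → T.depth a ≤ D → g a = 0)
    (hw : m * ((B : ℝ) - D) ≤ weight Y g) : T.opt m B ≤ 3 * Y.ncard := by
  refine opt_le_of_isGain hg hD hY (fun w hwY => ?_) hw
  obtain ⟨i, hi, hwi⟩ := h.cover w fun hwX => hwY (hXY hwX)
  have hwr := (h.isPart i hi).subset_below hwi
  refine ⟨(hmin i hi).trans (depth_le_of_mem_below hwr), fun a ha had => ?_⟩
  have hia := mem_below_of_depth_le ha hwr (had.trans (hmin i hi))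
  exact ⟨hXY (h.ancestorClosed.mem_of_mem_below (h.root_explored hi) hia), hzero i hi a hia had⟩

theorem opt_le_card (k B : ℕ) : T.opt k B ≤ 3 * (Set.univ : Set V).ncard := by
  obtain ⟨e, W, -, hcard⟩ := (T.isGreatest_opt k B).1
  rw [← hcard]
  have := Set.ncard_le_ncard (Set.subset_univ {w | ∃ i, w ∈ (W i).support}) (Set.toFinite _)
  lia

/-- The account is used for the least root depth `D` of an unfinished subtree, and the nonnegative
potentials are dropped. If no subtree is unfinished, everything is explored. -/
theorem Invariant.opt_le {B m : ℕ} {X : Set V} {F : Set (Subtree V)} (h : T.Invariant B m X F) :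
    T.opt m B ≤ 3 * X.ncard := by
  obtain ⟨A, hA, hacc⟩ := h
  rcases A.eq_empty_or_nonempty with rfl | hne
  · have : X = Set.univ := by
      refine Set.eq_univ_of_forall fun w => ?_
      by_contra hw
      obtain ⟨i, hi, -⟩ := hA.cover w hw
      simp at hi
    rw [this]
    exact opt_le_card m B
  · obtain ⟨i, hi, hmin⟩ := Finset.exists_min_image A (fun i => T.depth i.1.root) hne
    have hiB := hA.depth_le _ (hA.root_explored hi)
    obtain ⟨g, hg⟩ := hacc _ hiB ⟨i, hi, le_rfl⟩
    refine opt_le_of_account hiB hA subset_rfl hA.ancestorClosed hmin hg.isGain hg.gain_eq_zero ?_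
    have h1 := hg.le_weight
    have h2 : 0 ≤ ∑ i' ∈ A, T.potential B (T.depth i.1.root) i' :=
      Finset.sum_nonneg fun n hn => potential_nonneg hiB (hA.isPart n hn) (hA.searched n hn)
    linarith

end PortTree

namespace PortTree

variable {V : Type*} [Fintype V] {T : PortTree V}

/-! ### One iteration of the outer loop -/

theorem Advance.mono {B : ℕ} {S S' : Subtree V} {X Y : Set V} (h : T.Advance B S' X Y)
    (hS : S'.verts ⊆ S.verts) : T.Advance B S X Y :=
  ⟨h.subset, h.subset_union.trans (Set.union_subset_union_right _ hS), h.ancestorClosed, h.depth_le⟩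

theorem Advance.trans {B : ℕ} {S : Subtree V} {X Y Z : Set V} (h : T.Advance B S X Y)
    (h' : T.Advance B S Y Z) : T.Advance B S X Z where
  subset := h.subset.trans h'.subset
  subset_union := h'.subset_union.trans (Set.union_subset h.subset_union Set.subset_union_right)
  ancestorClosed := h'.ancestorClosed
  depth_le := fun w hw hwX => by
    by_cases hwY : w ∈ Y
    · exact h.depth_le w hwY hwX
    · exact h'.depth_le w hw hwY

theorem Advance.ncard_le {B : ℕ} {S : Subtree V} {X Y : Set V} (h : T.Advance B S X Y) :
    (X.ncard : ℝ) ≤ Y.ncard :=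
  Nat.cast_le.2 (Set.ncard_le_ncard h.subset (Set.toFinite _))

/-- `N` contains the subtree that results from `S` by moving down its root, if `S` has unexplored
vertices, and is empty otherwise. -/
structure Outcome (T : PortTree V) (S : Subtree V) (Y : Set V)
    (N : Finset (Subtree V × (Dir → V))) : Prop where
  eq_moveDown : ∀ n ∈ N, n.1 = T.moveDown Y S
  refines : ∀ n ∈ N, T.Refines S n.1 Y n.2
  not_subset : ∀ n ∈ N, ¬ n.1.verts ⊆ Y
  subsingleton : ∀ n ∈ N, ∀ n' ∈ N, n = n'
  exists_mem : ¬ S.verts ⊆ Y → ∃ n ∈ N, n.1 = T.moveDown Y S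

theorem outcome_empty {S : Subtree V} {Y : Set V} (h : S.verts ⊆ Y) : T.Outcome S Y ∅ :=
  ⟨by simp, by simp, by simp, by simp, fun hne => absurd h hne⟩

theorem outcome_singleton {S : Subtree V} {Y : Set V} {pos : Dir → V}
    (h : T.Refines S (T.moveDown Y S) Y pos) (hne : ¬ S.verts ⊆ Y) :
    T.Outcome S Y {(T.moveDown Y S, pos)} := by
  refine ⟨by simp, by simpa using h, ?_, by simp, fun _ => by simp⟩
  simp only [Finset.mem_singleton, forall_eq]
  obtain ⟨w, hwS, hwY⟩ := Set.not_subset.1 hne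
  exact fun hc => hwY (hc (h.unexplored_subset ⟨hwS, hwY⟩))

theorem Outcome.cover {S : Subtree V} {Y : Set V} {N : Finset (Subtree V × (Dir → V))}
    (h : T.Outcome S Y N) {w : V} (hw : w ∈ S.verts) (hwY : w ∉ Y) : ∃ n ∈ N, w ∈ n.1.verts := by
  obtain ⟨n, hn, -⟩ := h.exists_mem fun hc => hwY (hc hw)
  exact ⟨n, hn, (h.refines n hn).unexplored_subset ⟨hw, hwY⟩⟩

theorem Outcome.exists_pos_mem {S : Subtree V} {Y : Set V} {N : Finset (Subtree V × (Dir → V))}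
    (h : T.Outcome S Y N) (hne : ¬ (T.moveDown Y S).verts ⊆ Y) :
    ∃ pos, (T.moveDown Y S, pos) ∈ N := by
  obtain ⟨n, hn, heq⟩ := h.exists_mem fun hc => hne (by
    rwa [moveDown_of_stable (stable_of_subset hc)])
  exact ⟨n.2, heq ▸ hn⟩

theorem Outcome.congr {S : Subtree V} (hS : T.IsPart S) {Y Z : Set V}
    {N : Finset (Subtree V × (Dir → V))} (h : T.Outcome S Y N) (hYZ : Y ⊆ Z)
    (hagree : ∀ w ∈ S.verts, w ∈ Z → w ∈ Y) : T.Outcome S Z N := by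
  have hm : T.moveDown Y S = T.moveDown Z S :=
    moveDown_congr hS fun w hw => ⟨fun hwY => hYZ hwY, hagree w hw⟩
  refine ⟨hm ▸ h.eq_moveDown, fun n hn => ?_, fun n hn hc => ?_, h.subsingleton, fun hne => ?_⟩
  · have hr := h.refines n hn
    exact ⟨hr.isPart, hr.subset, fun w hw => hr.unexplored_subset ⟨hw.1, fun hwY => hw.2 (hYZ hwY)⟩,
      hr.searched.congr hYZ fun w hw => hagree w (hr.subset hw)⟩
  · exact h.not_subset n hn fun w hw => hagree w ((h.refines n hn).subset hw) (hc hw)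
  · rw [← hm]
    exact h.exists_mem fun hc => hne (hc.trans hYZ)

open Classical in
/-- The invariant is preserved if a subtree with a highest root is replaced by subtrees whose
potentials are paid for. -/
theorem Forest.invariant_replace {B m m' : ℕ} {X : Set V} {F : Set (Subtree V)}
    {A : Finset (Subtree V × (Dir → V))} (h : T.Forest B X F A) {c : ℝ}
    (hacc : ∀ D ≤ B, (∃ i ∈ A, T.depth i.1.root ≤ D) → ∃ g, T.Account B D X A m c g)
    {i : Subtree V × (Dir → V)} (hi : i ∈ A) (hmin : ∀ i' ∈ A, T.depth i.1.root ≤ T.depth i'.1.root)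
    {Y : Set V} (hadv : T.Advance B i.1 X Y) {N : Finset (Subtree V × (Dir → V))}
    {G : Set (Subtree V)} (href : ∀ n ∈ N, T.IsPart n.1 ∧ n.1.verts ⊆ i.1.verts ∧
      T.Searched n.1 Y n.2 ∧ ¬ n.1.verts ⊆ Y)
    (hdisj : ∀ n ∈ N, ∀ n' ∈ N, n ≠ n' → Disjoint (n.1.verts \ {n.1.root}) n'.1.verts)
    (hcover : ∀ w ∈ i.1.verts, w ∉ Y → ∃ n ∈ N, w ∈ n.1.verts) (hNG : ∀ n ∈ N, n.1 ∈ G)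
    (hAG : ∀ i' ∈ A, i' ≠ i → i'.1 ∈ G)
    (hG : ∀ S ∈ G, ¬ S.verts ⊆ Y → ∃ pos, (S, pos) ∈ A.erase i ∪ N)
    (hpay : ∀ D : ℝ, T.depth i.1.root ≤ D → D ≤ B → m' * ((B : ℝ) - D) +
      ∑ n ∈ N, ((B : ℝ) - T.depth i.1.root + 3 / 2 * T.spread n.1 n.2) + c ≤
      (2 + rate B D (T.depth i.1.root)) * ((Y.ncard : ℝ) - X.ncard) +
        ((B : ℝ) - T.depth i.1.root + 3 / 2 * T.spread i.1 i.2)) :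
    T.Invariant B (m + m') Y G := by
  have hpart := fun n hn => (href n hn).1
  have hsub := fun n hn => (href n hn).2.1
  have hsearched := fun n hn => (href n hn).2.2.1
  refine ⟨A.erase i ∪ N, h.replace hi hadv hpart hsub hsearched (fun n hn => (href n hn).2.2.2)
    hdisj hcover hNG hAG hG, fun D hD hDA => ?_⟩
  -- The chosen root is a highest one and new roots lie below it, so every `D` relevant afterwards
  -- already had an account.
  have hiD : T.depth i.1.root ≤ D := by
    obtain ⟨n, hn, hnD⟩ := hDA
    refine le_trans ?_ hnD
    rw [Finset.mem_union, Finset.mem_erase] at hn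
    rcases hn with hn | hn
    · exact hmin n hn.2
    · exact depth_le_of_mem_below ((h.isPart i hi).subset_below (hsub n hn (hpart n hn).root_mem))
  obtain ⟨g, hg⟩ := hacc D hD ⟨i, hi, hiD⟩
  obtain ⟨g', hg', -⟩ := hg.replace hD h hi hiD hadv hpart hsub hsearched (c' := 0) (m' := m') (by
    have := hpay D (by exact_mod_cast hiD) (by exact_mod_cast hD)
    linarith)
  exact ⟨g', hg'⟩

theorem Forest.exists_of_mem_highest {B : ℕ} {X : Set V} {F : Set (Subtree V)}
    {A : Finset (Subtree V × (Dir → V))} (h : T.Forest B X F A) {S : Subtree V}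
    (hS : S ∈ T.highest F X) : ∃ pos, (S, pos) ∈ A ∧
      (∀ i' ∈ A, T.depth S.root ≤ T.depth i'.1.root) ∧ T.depth S.root ≤ B := by
  obtain ⟨pos, hpos⟩ := h.of_mem_family S hS.1 hS.2.1
  exact ⟨pos, hpos, fun i' hi' => hS.2.2 _ (h.mem_family i' hi') (h.not_subset i' hi'),
    h.depth_le _ (h.root_explored hpos)⟩

/-- If the last agent searches a subtree with a highest root, then the bound holds. -/
theorem Invariant.opt_succ_le {B m : ℕ} {X : Set V} {F : Set (Subtree V)}
    (h : T.Invariant B m X F) {S : Subtree V} (hS : S ∈ T.highest F X) {Y : Set V}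
    (hadv : T.Advance B S X Y) : T.opt (m + 1) B ≤ 3 * Y.ncard := by
  classical
  obtain ⟨A, hA, hacc⟩ := h
  obtain ⟨pos, hi, hmin, hB⟩ := hA.exists_of_mem_highest hS
  have hpart : T.IsPart S := hA.isPart _ hi
  have hsearched : T.Searched S X pos := hA.searched _ hi
  obtain ⟨g, hg⟩ := hacc _ hB ⟨_, hi, le_rfl⟩
  have hB' : (T.depth S.root : ℝ) ≤ B := by exact_mod_cast hB
  -- For `D` the root depth of `S`, the discarded potential of `S` is at least `B - D`. It pays for
  -- the last agent, however little that agent explores.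
  obtain ⟨g', hg', hzero⟩ := hg.replace (N := ∅) (m' := 1) (c' := 0) hB hA hi le_rfl hadv (by simp)
    (by simp) (by simp) (by
      have h1 := spread_nonneg hpart hsearched
      have h2 := rate_nonneg (B := B) le_rfl hB'
      have h3 := mul_nonneg (add_nonneg zero_le_two h2) (sub_nonneg.2 hadv.ncard_le)
      simp only [Nat.cast_one, one_mul, Finset.sum_empty, add_zero]
      linarith)
  refine opt_le_of_account hB hA hadv.subset hadv.ancestorClosed hmin hg'.isGain
    (fun i' hi' a ha had => hzero a (hA.ancestorClosed.mem_of_mem_below (hA.root_explored hi') ha)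
      (hg.gain_eq_zero i' hi' a ha had)) ?_
  have h1 := hg'.le_weight
  have h2 : 0 ≤ ∑ i' ∈ A.erase (S, pos) ∪ ∅, T.potential B (T.depth S.root) i' :=
    Finset.sum_nonneg fun n hn => by
      rw [Finset.union_empty] at hn
      have hn' := Finset.mem_of_mem_erase hn
      exact potential_nonneg hB (hA.isPart n hn') (hA.searched n hn')
  linarith

open Classical in
/-- The subtrees that an iteration does not change. -/
theorem Forest.exists_mem_erase {B : ℕ} {X : Set V} {F : Set (Subtree V)}
    {A : Finset (Subtree V × (Dir → V))} (h : T.Forest B X F A) (hst : ∀ S ∈ F, T.Stable S X)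
    {S : Subtree V} {pos : Dir → V} (hi : (S, pos) ∈ A) {Y : Set V} (hadv : T.Advance B S X Y)
    {S₀ : Subtree V} (hS₀ : S₀ ∈ F) (hne : S₀ ≠ S) (hopen : ¬ (T.moveDown Y S₀).verts ⊆ Y) :
    ∃ pos', (T.moveDown Y S₀, pos') ∈ A.erase (S, pos) := by
  have hS₀Y : ¬ S₀.verts ⊆ Y := fun hc => hopen (by
    rwa [moveDown_of_stable (stable_of_subset hc)])
  obtain ⟨pos', hpos'⟩ := h.of_mem_family S₀ hS₀ fun hc => hS₀Y (hc.trans hadv.subset)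
  have hne' : (S, pos) ≠ (S₀, pos') := fun heq => hne (congrArg Prod.fst heq).symm
  refine ⟨pos', ?_⟩
  rw [moveDown_of_stable (h.stable hi hpos' hne' hadv.subset hadv.subset_union (hst S₀ hS₀))]
  exact Finset.mem_erase.2 ⟨hne'.symm, hpos'⟩

/-- An iteration in which an agent starts at the first unexplored vertex of a subtree. -/
theorem Invariant.near {B m : ℕ} {X : Set V} {F : Set (Subtree V)} (h : T.Invariant B m X F)
    (hst : ∀ S ∈ F, T.Stable S X) {S : Subtree V} (hS : S ∈ T.highest F X) {dir : Dir}
    (hnear : T.Near B S (T.extremeUnexplored dir S X)) :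
    T.Invariant B (m + 1) (T.runAgent B dir S (T.extremeUnexplored dir S X) X)
      (T.moveDown (T.runAgent B dir S (T.extremeUnexplored dir S X) X) '' F) := by
  classical
  obtain ⟨A, hA, hacc⟩ := h
  obtain ⟨pos, hi, hmin, hB⟩ := hA.exists_of_mem_highest hS
  have hpart : T.IsPart S := hA.isPart _ hi
  have hsearched : T.Searched S X pos := hA.searched _ hi
  obtain ⟨hadv, hout⟩ := near_search hpart hA.ancestorClosed hsearched (hst S hS.1) hS.2.1 hB rfl
    hnear rfl
  set Y := T.runAgent B dir S (T.extremeUnexplored dir S X) X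
  obtain ⟨N, hN, hpay⟩ : ∃ N, T.Outcome S Y N ∧ ∀ D : ℝ, T.depth S.root ≤ D → D ≤ B →
      ((B : ℝ) - D) + ∑ n ∈ N, ((B : ℝ) - T.depth S.root + 3 / 2 * T.spread n.1 n.2) ≤
      (2 + rate B D (T.depth S.root)) * ((Y.ncard : ℝ) - X.ncard) +
        ((B : ℝ) - T.depth S.root + 3 / 2 * T.spread S pos) := by
    by_cases hfull : S.verts ⊆ Y
    · refine ⟨∅, outcome_empty hfull, fun D hD hDB => ?_⟩
      have h1 := spread_nonneg hpart hsearched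
      have h3 := mul_nonneg (add_nonneg zero_le_two (rate_nonneg hD hDB))
        (sub_nonneg.2 hadv.ncard_le)
      simp only [Finset.sum_empty, add_zero]
      linarith
    · obtain ⟨pos', href, hle⟩ := hout.resolve_left hfull
      refine ⟨_, outcome_singleton href hfull, fun D hD hDB => ?_⟩
      have := hle D hD hDB
      rw [Finset.sum_singleton]
      linarith
  refine hA.invariant_replace hacc hi hmin hadv (N := N) (fun n hn => ⟨(hN.refines n hn).isPart,
    (hN.refines n hn).subset, (hN.refines n hn).searched, hN.not_subset n hn⟩)
    (fun n hn n' hn' hne => absurd (hN.subsingleton n hn n' hn') hne)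
    (fun w hw hwY => hN.cover hw hwY) (fun n hn => ⟨S, hS.1, (hN.eq_moveDown n hn).symm⟩)
    (fun i' hi' hne => ⟨i'.1, hA.mem_family i' hi', moveDown_of_stable (hA.stable hi hi' hne.symm
      hadv.subset hadv.subset_union (hst _ (hA.mem_family i' hi')))⟩) ?_ (fun D hD hDB => ?_)
  · rintro _ ⟨S₀, hS₀, rfl⟩ hopen
    by_cases hSS : S₀ = S
    · subst hSS
      obtain ⟨pos', hpos'⟩ := hN.exists_pos_mem hopen
      exact ⟨pos', Finset.mem_union_right _ hpos'⟩
    · obtain ⟨pos', hpos'⟩ := hA.exists_mem_erase hst hi hadv hS₀ hSS hopen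
      exact ⟨pos', Finset.mem_union_left _ hpos'⟩
  · simpa using hpay D hD hDB

/-- The search of one part of a subtree that has been split. -/
theorem half_search {S : Subtree V} (hS : T.IsPart S) {X : Set V} (hX : T.AncestorClosed X)
    {pos : Dir → V} (h : T.Searched S X pos) (hne : ¬ S.verts ⊆ X) {B : ℕ} {dir : Dir}
    (hdir : pos dir = S.root) (hB : T.depth S.root ≤ B)
    (hfar : (B : ℝ) - T.depth S.root ≤ 3 * (T.depth (pos dir.swap) + 1 - T.depth S.root))
    {Y : Set V} (hY : T.runAgent B dir S S.root X = Y) :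
    T.Advance B S X Y ∧ ∃ N, T.Outcome S Y N ∧ ∀ D : ℝ, T.depth S.root ≤ D → D ≤ B →
      ((B : ℝ) - D) + ∑ n ∈ N, ((B : ℝ) - T.depth S.root + 3 / 2 * T.spread n.1 n.2) ≤
      (2 + rate B D (T.depth S.root)) * ((Y.ncard : ℝ) - X.ncard) +
        (((B : ℝ) - T.depth S.root) / 2 +
          3 / 2 * ((T.depth (pos dir.swap) : ℝ) - T.depth S.root)) := by
  obtain ⟨hadv, hout⟩ := root_search hS hX h hdir hB hY
  refine ⟨hadv, ?_⟩
  by_cases hfull : S.verts ⊆ Y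
  · refine ⟨∅, outcome_empty hfull, fun D hD hDB => ?_⟩
    -- Only a search that completes its part needs `hfar`: half of `B - d(r_S)` is available, and
    -- `hfar` bounds the other half by `3/2` of the remaining distance plus `3/2`. One new vertex,
    -- of weight at least 2, covers this last term.
    have hlt : X.ncard < Y.ncard := by
      refine Set.ncard_lt_ncard ⟨hadv.subset, fun hc => hne (hfull.trans hc)⟩ (Set.toFinite _)
    have hlt' : (1 : ℝ) ≤ (Y.ncard : ℝ) - X.ncard := by
      have : (X.ncard : ℝ) + 1 ≤ Y.ncard := by exact_mod_cast hlt
      linarith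
    have h2 := rate_nonneg hD hDB
    have h3 : 2 ≤ (2 + rate B D (T.depth S.root)) * ((Y.ncard : ℝ) - X.ncard) := by nlinarith
    simp only [Finset.sum_empty, add_zero]
    linarith
  · obtain ⟨pos', href, hle⟩ := hout.resolve_left hfull
    refine ⟨_, outcome_singleton href hfull, fun D hD hDB => ?_⟩
    have := hle D hD hDB
    rw [Finset.sum_singleton]
    linarith

theorem childToward_spec {u w : V} (h : w ∈ T.below u) (hne : w ≠ u) :
    ∃ p ∈ T.childPorts .left u, T.childToward u w = T.nbr u p ∧ w ∈ T.below (T.nbr u p) := by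
  classical
  obtain ⟨p, hp, hwp⟩ := (eq_or_mem_below_child .left h).resolve_left hne
  have key : ∀ P : ℕ → Bool, (∀ q, P q = true ↔ w ∈ T.below (T.nbr u q)) →
      ∃ q ∈ T.childPorts .left u,
        T.nbr u (((T.childPorts .left u).find? P).getD 0) = T.nbr u q ∧ w ∈ T.below (T.nbr u q) := by
    intro P hP
    cases hf : (T.childPorts .left u).find? P with
    | none =>
      rw [List.find?_eq_none] at hf
      exact absurd ((hP p).2 hwp) (hf p hp)
    | some q =>
      exact ⟨q, List.mem_of_find?_eq_some hf, rfl, (hP q).1 (List.find?_some hf)⟩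
  unfold childToward
  exact key _ fun q => by simp

end PortTree

namespace PortTree

variable {V : Type*} [Fintype V] {T : PortTree V}

/-! ### Splitting a subtree -/

theorem isPart_splitFst {S : Subtree V} (hS : T.IsPart S) {p : ℕ}
    (hp : p ∈ T.childPorts .left S.root) : T.IsPart (T.splitFst S (T.nbr S.root p)) where
  root_mem := ⟨hS.root_mem, not_mem_below_child hp⟩
  subset_below := fun _ hw => hS.subset_below hw.1
  below_subset := by
    rintro w ⟨hw, hwv⟩ hwr x hx
    refine ⟨hS.below_subset w hw hwr hx, fun hxv => ?_⟩
    rcases mem_below_or_mem_below hx hxv with h | h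
    · exact hwv h
    · by_cases hvw : T.nbr S.root p = w
      · exact hwv (hvw ▸ T.mem_below_self _)
      · have h1 := parent_mem_below h hvw
        rw [T.parent_child hp] at h1
        exact hwr (eq_of_mem_below_of_depth_le (hS.subset_below hw) (depth_le_of_mem_below h1))
  parent_mem := by
    rintro w ⟨hw, hwv⟩ hwr
    refine ⟨hS.parent_mem w hw hwr, fun h => hwv (mem_below_of_parent ?_ h)⟩
    exact ne_root_of_mem_below (hS.subset_below hw) hwr

theorem isPart_splitSnd {S : Subtree V} (hS : T.IsPart S) {p : ℕ}
    (hp : p ∈ T.childPorts .left S.root) : T.IsPart (T.splitSnd S (T.nbr S.root p)) where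
  root_mem := Set.mem_insert _ _
  subset_below := by
    rintro w (rfl | hw)
    · exact T.mem_below_self _
    · exact hS.subset_below hw.1
  below_subset := by
    rintro w (rfl | hw) hwr
    · exact absurd rfl hwr
    · exact fun x hx => .inr ⟨hS.below_subset w hw.1 hwr hx, mem_below_trans hw.2 hx⟩
  parent_mem := by
    rintro w (rfl | hw) hwr
    · exact absurd rfl hwr
    · by_cases hwv : w = T.nbr S.root p
      · left
        rw [hwv, T.parent_child hp]
      · exact .inr ⟨hS.parent_mem w hw.1 hwr, parent_mem_below hw.2 hwv⟩

theorem splitFst_subset (S : Subtree V) (v : V) : (T.splitFst S v).verts ⊆ S.verts :=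
  Set.sdiff_subset

theorem splitSnd_subset {S : Subtree V} (hS : T.IsPart S) (v : V) :
    (T.splitSnd S v).verts ⊆ S.verts := by
  rintro w (rfl | hw)
  · exact hS.root_mem
  · exact hw.1

theorem eq_root_of_mem_split {S : Subtree V} {v w : V} (h₁ : w ∈ (T.splitFst S v).verts)
    (h₂ : w ∈ (T.splitSnd S v).verts) : w = S.root :=
  h₂.resolve_right fun h => h₁.2 h.2

/-- After a split, the searches on the new sides start at the root. -/
theorem Searched.restart {S S' : Subtree V} (hS' : T.IsPart S') (hroot : S'.root = S.root)
    (hsub : S'.verts ⊆ S.verts) {X : Set V} {pos : Dir → V} (h : T.Searched S X pos)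
    (hrX : S.root ∈ X) {dir : Dir} (hmem : pos dir.swap ∈ S'.verts)
    (hanc : ∀ u ∈ S'.verts, u ≠ S.root → pos dir ∉ T.below u) :
    T.Searched S' X (Function.update pos dir S.root) := by
  have hcases : ∀ d, d ≠ dir → d = dir.swap := fun d hd => (Dir.eq_or_eq_swap dir d).resolve_left hd
  refine ⟨fun d => ?_, fun d => ?_, fun d => ?_, fun u hu huX ho => ?_⟩
  · by_cases hd : d = dir
    · subst hd
      rw [Function.update_self, ← hroot]
      exact hS'.root_mem
    · rw [Function.update_of_ne hd, hcases d hd]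
      exact hmem
  · by_cases hd : d = dir
    · subst hd
      rwa [Function.update_self]
    · rw [Function.update_of_ne hd]
      exact h.pos_explored d
  · by_cases hd : d = dir
    · subst hd
      rw [Function.update_self, ← hroot]
      exact side_root hS' X d
    · rw [Function.update_of_ne hd]
      exact (h.side d).anti hsub
  · by_cases hur : u = S.root
    · refine ⟨dir, ?_⟩
      rw [Function.update_self, hur]
      exact T.mem_below_self _
    · obtain ⟨d, hd⟩ := h.open_ancestor u (hsub hu) huX fun hc => ho (hc.anti hsub)
      refine ⟨d, ?_⟩
      by_cases hdd : d = dir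
      · subst hdd
        exact absurd hd (hanc u hu hur)
      · rwa [Function.update_of_ne hdd]

/-- The configuration of a subtree that is split: the leftmost and the rightmost unexplored vertex
lie far away from the root, below different children of the root. -/
theorem split_config {S : Subtree V} (hS : T.IsPart S) {X : Set V} (hX : T.AncestorClosed X)
    {pos : Dir → V} (h : T.Searched S X pos) (hst : T.Stable S X) (hne : ¬ S.verts ⊆ X) {B : ℕ}
    (hL : ¬ T.Near B S (T.extremeUnexplored .left S X))
    (hR : ¬ T.Near B S (T.extremeUnexplored .right S X)) :
    ∃ p ∈ T.childPorts .left S.root,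
      T.childToward S.root (T.extremeUnexplored .right S X) = T.nbr S.root p ∧
      T.extremeUnexplored .right S X ∈ T.below (T.nbr S.root p) ∧
      pos .right ∈ T.below (T.nbr S.root p) ∧
      T.extremeUnexplored .left S X ∉ T.below (T.nbr S.root p) ∧
      pos .left ∉ T.below (T.nbr S.root p) ∧
      ∀ d, (B : ℝ) - T.depth S.root ≤ 3 * (T.depth (pos d) + 1 - T.depth S.root) := by
  have hrX := h.root_explored hS hX
  have hfar : ∀ d, ¬ T.Near B S (T.extremeUnexplored d S X) := fun d => by cases d <;> assumption
  have hfar' : ∀ d, (1 : ℝ) < (T.depth (T.extremeUnexplored d S X) : ℝ) - T.depth S.root ∧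
      1 / 3 * ((B : ℝ) - T.depth S.root) <
        (T.depth (T.extremeUnexplored d S X) : ℝ) - T.depth S.root := by
    intro d
    have h1 := (Rat.cast_lt (K := ℝ)).2 (not_le.1 (hfar d))
    push_cast at h1
    exact max_lt_iff.1 h1
  have hdeep : ∀ d, T.depth S.root + 1 < T.depth (T.extremeUnexplored d S X) := by
    intro d
    have h1 : (T.depth S.root : ℝ) + 1 < T.depth (T.extremeUnexplored d S X) := by
      linarith [(hfar' d).1]
    exact_mod_cast h1
  have hspec := fun d => extremeUnexplored_spec hS hrX hne d
  have hpos := fun d => h.extremeUnexplored_position hS hX hst hne d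
  have hport : ∀ d, ∃ p ∈ T.childPorts .left S.root,
      T.nbr (T.extremeUnexplored d S X) 0 ∈ T.below (T.nbr S.root p) := by
    intro d
    have hvr : T.extremeUnexplored d S X ≠ S.root := fun hv => (hspec d).2.1 (hv ▸ hrX)
    have hpS := hS.parent_mem _ (hspec d).1 hvr
    refine (eq_or_mem_below_child .left (hS.subset_below hpS)).resolve_left fun heq => ?_
    have h1 := T.depth_parent (hspec d).2.2.1
    rw [heq] at h1
    have := hdeep d
    lia
  have hvp : ∀ d {p}, T.nbr (T.extremeUnexplored d S X) 0 ∈ T.below (T.nbr S.root p) →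
      T.extremeUnexplored d S X ∈ T.below (T.nbr S.root p) := fun d p hp =>
    mem_below_of_parent (hspec d).2.2.1 hp
  obtain ⟨p, hp, hpp⟩ := hport .right
  obtain ⟨q, hq, hqq⟩ := hport .left
  -- If both extreme vertices were below the same child, then the second open child given by
  -- stability would precede one of them in its own search order.
  have hpq : q ≠ p := by
    rintro rfl
    obtain ⟨q', hq', hne', ho⟩ := hst q hq (hX.mem_of_mem_below (hspec .left).2.2.2.1 hqq)
      fun hc => (hspec .left).2.1 (hc ⟨(hspec .left).1, hvp .left hqq⟩)
    rcases Dir.before_or_before .left hne' with hb | hb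
    · exact ho ((hspec .left).2.2.2.2 _ q hq q' hq' hb (hvp .left hqq))
    · exact ho ((hspec .right).2.2.2.2 _ q hq q' hq' hb (hvp .right hpp))
  obtain ⟨p', hp', hchild, hvp'⟩ := childToward_spec (hS.subset_below (hspec .right).1)
    fun hv => (hspec .right).2.1 (hv ▸ hrX)
  obtain rfl := childPort_eq hp hp' (hvp .right hpp) hvp'
  refine ⟨p, hp, hchild, hvp', mem_below_trans hpp ((hpos .right).2 (hdeep .right)),
    fun hc => hpq (childPort_eq hq hp (hvp .left hqq) hc),
    fun hc => hpq (childPort_eq hq hp (mem_below_trans hqq ((hpos .left).2 (hdeep .left))) hc),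
    fun d => ?_⟩
  have h1 : (T.depth (T.extremeUnexplored d S X) : ℝ) ≤ T.depth (pos d) + 1 := by
    exact_mod_cast (hpos d).1
  linarith [(hfar' d).2]

/-- An iteration in which a subtree is split, up to the first of the two searches. -/
theorem Invariant.split_fst {B m : ℕ} {X : Set V} {F : Set (Subtree V)} (h : T.Invariant B m X F)
    (hst : ∀ S ∈ F, T.Stable S X) {S : Subtree V} (hS : S ∈ T.highest F X)
    (hL : ¬ T.Near B S (T.extremeUnexplored .left S X))
    (hR : ¬ T.Near B S (T.extremeUnexplored .right S X)) :
    T.Advance B S X (T.runAgent B .right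
      (T.splitFst S (T.childToward S.root (T.extremeUnexplored .right S X))) S.root X) := by
  obtain ⟨A, hA, -⟩ := h
  obtain ⟨pos, hi, -, hB⟩ := hA.exists_of_mem_highest hS
  have hpart : T.IsPart S := hA.isPart _ hi
  have hX := hA.ancestorClosed
  have hsearched : T.Searched S X pos := hA.searched _ hi
  have hrX := hsearched.root_explored hpart hX
  obtain ⟨p, hp, hv, hvR, hposR, hvL, hposL, hfar⟩ :=
    split_config hpart hX hsearched (hst S hS.1) hS.2.1 hL hR
  rw [hv]
  have hpart₁ := isPart_splitFst hpart hp
  have h₁ : T.Searched (T.splitFst S (T.nbr S.root p)) X (Function.update pos .right S.root) := by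
    refine hsearched.restart (S := S) hpart₁ rfl (splitFst_subset _ _) hrX ⟨hsearched.pos_mem _, hposL⟩ ?_
    rintro u hu hur hc
    exact (hpart₁.below_subset u hu hur hc).2 hposR
  exact (runAgent_root hpart₁ hX h₁ (dir := .right) (by simp [splitFst]) hB).1.mono
    (splitFst_subset _ _)

/-- An iteration in which a subtree is split. -/
theorem Invariant.split {B m : ℕ} {X : Set V} {F : Set (Subtree V)} (h : T.Invariant B m X F)
    (hst : ∀ S ∈ F, T.Stable S X) {S : Subtree V} (hS : S ∈ T.highest F X)
    (hL : ¬ T.Near B S (T.extremeUnexplored .left S X))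
    (hR : ¬ T.Near B S (T.extremeUnexplored .right S X)) {v : V}
    (hvdef : T.childToward S.root (T.extremeUnexplored .right S X) = v) {X₁ X₂ : Set V}
    (hX₁ : T.runAgent B .right (T.splitFst S v) S.root X = X₁)
    (hX₂ : T.runAgent B .left (T.splitSnd S v) S.root X₁ = X₂) :
    T.Invariant B (m + 2) X₂
      (T.moveDown X₂ '' ((F \ {S}) ∪ {T.splitFst S v, T.splitSnd S v})) := by
  classical
  obtain ⟨A, hA, hacc⟩ := h
  obtain ⟨pos, hi, hmin, hB⟩ := hA.exists_of_mem_highest hS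
  have hpart : T.IsPart S := hA.isPart _ hi
  have hX := hA.ancestorClosed
  have hsearched : T.Searched S X pos := hA.searched _ hi
  have hrX := hsearched.root_explored hpart hX
  obtain ⟨p, hp, hv, hvR, hposR, hvL, hposL, hfar⟩ :=
    split_config hpart hX hsearched (hst S hS.1) hS.2.1 hL hR
  obtain rfl : T.nbr S.root p = v := hv.symm.trans hvdef
  set v := T.nbr S.root p
  have hspec := fun d => extremeUnexplored_spec hpart hrX hS.2.1 d
  have hpart₁ : T.IsPart (T.splitFst S v) := isPart_splitFst hpart hp
  have hpart₂ : T.IsPart (T.splitSnd S v) := isPart_splitSnd hpart hp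
  have hsub₁ : (T.splitFst S v).verts ⊆ S.verts := splitFst_subset _ _
  have hsub₂ : (T.splitSnd S v).verts ⊆ S.verts := splitSnd_subset hpart _
  have h₁ : T.Searched (T.splitFst S v) X (Function.update pos .right S.root) := by
    refine hsearched.restart (S := S) hpart₁ rfl hsub₁ hrX ⟨hsearched.pos_mem _, hposL⟩ ?_
    rintro u hu hur hc
    exact (hpart₁.below_subset u hu hur hc).2 hposR
  obtain ⟨hadv₁, N₁, hN₁, hpay₁⟩ := half_search hpart₁ hX h₁
    (fun hc => (hspec .left).2.1 (hc ⟨(hspec .left).1, hvL⟩)) (dir := .right)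
    (Function.update_self _ _ _) hB (hfar .left) hX₁
  -- The two parts share only their explored root, so neither search affects the other part.
  have hagree₁ : ∀ w ∈ (T.splitSnd S v).verts, w ∈ X₁ → w ∈ X := by
    intro w hw hw₁
    rcases hadv₁.subset_union hw₁ with h1 | h1
    · exact h1
    · rw [eq_root_of_mem_split h1 hw]
      exact hrX
  have h₂ : T.Searched (T.splitSnd S v) X (Function.update pos .left S.root) := by
    refine hsearched.restart (S := S) hpart₂ rfl hsub₂ hrX (.inr ⟨hsearched.pos_mem _, hposR⟩) ?_
    rintro u (hu | hu) hur hc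
    · exact hur hu
    · exact hposL (mem_below_trans hu.2 hc)
  obtain ⟨hadv₂, N₂, hN₂, hpay₂⟩ := half_search hpart₂ hadv₁.ancestorClosed
    (h₂.congr hadv₁.subset hagree₁)
    (fun hc => (hspec .right).2.1 (hagree₁ _ (.inr ⟨(hspec .right).1, hvR⟩)
      (hc (.inr ⟨(hspec .right).1, hvR⟩)))) (dir := .left)
    (Function.update_self _ _ _) hB (hfar .right) hX₂
  have hadv : T.Advance B S X X₂ := (hadv₁.mono hsub₁).trans (hadv₂.mono hsub₂)
  have hagree₂ : ∀ w ∈ (T.splitFst S v).verts, w ∈ X₂ → w ∈ X₁ := by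
    intro w hw hw₁
    rcases hadv₂.subset_union hw₁ with h1 | h1
    · exact h1
    · rw [eq_root_of_mem_split hw h1]
      exact hadv₁.subset hrX
  have hN₁' := hN₁.congr hpart₁ hadv₂.subset hagree₂
  have href : ∀ n ∈ N₁ ∪ N₂, T.IsPart n.1 ∧ n.1.verts ⊆ S.verts ∧
      T.Searched n.1 X₂ n.2 ∧ ¬ n.1.verts ⊆ X₂ := by
    intro n hn
    rcases Finset.mem_union.1 hn with hn | hn
    · have hr := hN₁'.refines n hn
      exact ⟨hr.isPart, hr.subset.trans hsub₁, hr.searched, hN₁'.not_subset n hn⟩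
    · have hr := hN₂.refines n hn
      exact ⟨hr.isPart, hr.subset.trans hsub₂, hr.searched, hN₂.not_subset n hn⟩
  refine hA.invariant_replace hacc hi hmin hadv href ?_ ?_ ?_ ?_ ?_ (fun D hD hDB => ?_)
  · intro n hn n' hn' hne
    rcases Finset.mem_union.1 hn with hn | hn <;> rcases Finset.mem_union.1 hn' with hn' | hn'
    · exact absurd (hN₁.subsingleton n hn n' hn') hne
    · have hd := (hN₁'.refines n hn).isPart.diff_root_subset hpart₁ (hN₁'.refines n hn).subset
      refine Set.disjoint_left.2 fun w hw hw' => (hd hw).2 ?_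
      exact eq_root_of_mem_split (S := S) (hd hw).1 ((hN₂.refines n' hn').subset hw')
    · have hd := (hN₂.refines n hn).isPart.diff_root_subset hpart₂ (hN₂.refines n hn).subset
      refine Set.disjoint_left.2 fun w hw hw' => (hd hw).2 ?_
      exact eq_root_of_mem_split (S := S) ((hN₁'.refines n' hn').subset hw') (hd hw).1
    · exact absurd (hN₂.subsingleton n hn n' hn') hne
  · intro w hw hwX
    by_cases hwv : w ∈ T.below v
    · obtain ⟨n, hn, hwn⟩ := hN₂.cover (.inr ⟨hw, hwv⟩) hwX
      exact ⟨n, Finset.mem_union_right _ hn, hwn⟩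
    · obtain ⟨n, hn, hwn⟩ := hN₁'.cover ⟨hw, hwv⟩ hwX
      exact ⟨n, Finset.mem_union_left _ hn, hwn⟩
  · intro n hn
    rcases Finset.mem_union.1 hn with hn | hn
    · exact ⟨_, .inr (.inl rfl), (hN₁'.eq_moveDown n hn).symm⟩
    · exact ⟨_, .inr (.inr rfl), (hN₂.eq_moveDown n hn).symm⟩
  · intro i' hi' hne
    refine ⟨i'.1, .inl ⟨hA.mem_family i' hi', fun heq => ?_⟩, moveDown_of_stable (hA.stable hi hi'
      hne.symm hadv.subset hadv.subset_union (hst _ (hA.mem_family i' hi')))⟩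
    have heq' : i'.1 = S := heq
    obtain ⟨w, hw, hwX⟩ := Set.not_subset.1 hS.2.1
    refine Set.disjoint_left.1 (hA.disjoint _ hi i' hi' hne.symm) ⟨hw, ?_⟩ (heq' ▸ hw)
    rintro rfl
    exact hwX hrX
  · rintro _ ⟨S₀, hS₀, rfl⟩ hopen
    rcases hS₀ with hS₀ | rfl | rfl
    · obtain ⟨pos', hpos'⟩ := hA.exists_mem_erase hst hi hadv hS₀.1 hS₀.2 hopen
      exact ⟨pos', Finset.mem_union_left _ hpos'⟩
    · obtain ⟨pos', hpos'⟩ := hN₁'.exists_pos_mem hopen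
      exact ⟨pos', Finset.mem_union_right _ (Finset.mem_union_left _ hpos')⟩
    · obtain ⟨pos', hpos'⟩ := hN₂.exists_pos_mem hopen
      exact ⟨pos', Finset.mem_union_right _ (Finset.mem_union_right _ hpos')⟩
  · have k₁ := hpay₁ D hD hDB
    have k₂ := hpay₂ D hD hDB
    have e₁ : (T.splitFst S v).root = S.root := rfl
    have e₂ : (T.splitSnd S v).root = S.root := rfl
    rw [e₁, Function.update_of_ne (Dir.swap_ne _)] at k₁
    rw [e₂, Function.update_of_ne (Dir.swap_ne _)] at k₂
    have hsum : ∑ n ∈ N₁ ∪ N₂, ((B : ℝ) - T.depth S.root + 3 / 2 * T.spread n.1 n.2) ≤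
        ∑ n ∈ N₁, ((B : ℝ) - T.depth S.root + 3 / 2 * T.spread n.1 n.2) +
        ∑ n ∈ N₂, ((B : ℝ) - T.depth S.root + 3 / 2 * T.spread n.1 n.2) := by
      rw [← Finset.sum_union_inter]
      refine le_add_of_nonneg_right (Finset.sum_nonneg fun n hn => ?_)
      have hr := href n (Finset.mem_union_left _ (Finset.mem_inter.1 hn).1)
      have h1 := spread_nonneg hr.1 hr.2.2.1
      linarith
    have hspread : T.spread S pos = ((T.depth (pos Dir.right.swap) : ℝ) - T.depth S.root) +
        ((T.depth (pos Dir.left.swap) : ℝ) - T.depth S.root) := rfl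
    simp only [hspread]
    push_cast
    linarith

/-! ### The main theorem -/

theorem dfsLoop_univ (dir : Dir) (S : Subtree V) (e : ℕ) (u : V) :
    T.dfsLoop dir S e u Set.univ = Set.univ := by
  cases e with
  | zero => rfl
  | succ e => simp [dfsLoop]

theorem exploreLoop_univ (B : ℕ) (tie : ℕ → Set (Subtree V) → Subtree V) (k : ℕ)
    (F : Set (Subtree V)) : T.exploreLoop B tie k Set.univ F = Set.univ := by
  cases k with
  | zero => rfl
  | succ k => simp [exploreLoop]

theorem Invariant.highest_nonempty {B m : ℕ} {X : Set V} {F : Set (Subtree V)}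
    (h : T.Invariant B m X F) (hX : X ≠ Set.univ) : (T.highest F X).Nonempty := by
  obtain ⟨A, hA, -⟩ := h
  obtain ⟨w, hw⟩ := (Set.ne_univ_iff_exists_notMem X).1 hX
  obtain ⟨i₀, hi₀, -⟩ := hA.cover w hw
  obtain ⟨i, hi, hmin⟩ := Finset.exists_min_image A (fun i => T.depth i.1.root) ⟨i₀, hi₀⟩
  refine ⟨i.1, hA.mem_family i hi, hA.not_subset i hi, fun S' hS' hne => ?_⟩
  obtain ⟨pos, hpos⟩ := hA.of_mem_family S' hS' hne
  exact hmin _ hpos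

/-- The invariant is stated for the family after the inner loop, where all members are stable. The
induction is strong because a split uses two agents. -/
theorem opt_le_exploreLoop {B : ℕ} {tie : ℕ → Set (Subtree V) → Subtree V}
    (htie : ∀ (n : ℕ) (A : Set (Subtree V)), A.Nonempty → tie n A ∈ A) (k m : ℕ) (X : Set V)
    (F : Set (Subtree V)) (h : T.Invariant B m X (T.moveDown X '' F)) :
    T.opt (m + k) B ≤ 3 * (T.exploreLoop B tie k X F).ncard := by
  induction k using Nat.strong_induction_on generalizing m X F with
  | _ k ih =>
    cases k with
    | zero => simpa [exploreLoop] using h.opt_le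
    | succ k =>
      by_cases hX : X = Set.univ
      · subst hX
        rw [exploreLoop_univ]
        exact opt_le_card _ _
      have hst : ∀ S ∈ T.moveDown X '' F, T.Stable S X := by
        rintro _ ⟨S, -, rfl⟩
        exact stable_moveDown X S
      rw [exploreLoop, if_neg hX]
      have hS := htie k _ (h.highest_nonempty hX)
      set F' := T.moveDown X '' F
      set S := tie k (T.highest F' X)
      have hm : m + (k + 1) = m + 1 + k := by lia
      simp only
      split_ifs with hL hR
      · rw [hm]
        exact ih k (by lia) _ _ _ (h.near hst hS hL)
      · rw [hm]
        exact ih k (by lia) _ _ _ (h.near hst hS hR)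
      · cases k with
        | zero => exact h.opt_succ_le hS (h.split_fst hst hS hL hR)
        | succ k =>
          have hm' : m + (k + 1 + 1) = m + 2 + k := by lia
          rw [hm']
          exact ih k (by lia) _ _ _ (h.split hst hS hL hR rfl rfl rfl)

theorem isPart_whole : T.IsPart T.whole where
  root_mem := Set.mem_univ _
  subset_below := fun w _ => T.mem_below_root w
  below_subset := fun _ _ _ => Set.subset_univ _
  parent_mem := fun _ _ _ => Set.mem_univ _

theorem ancestorClosed_root : T.AncestorClosed {T.root} :=
  fun _ hw hwr => absurd hw hwr

theorem searched_whole : T.Searched T.whole {T.root} fun _ => T.root where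
  pos_mem := fun _ => Set.mem_univ _
  pos_explored := fun _ => rfl
  side := fun d => side_root isPart_whole _ d
  open_ancestor := by
    rintro u - rfl -
    exact ⟨.left, T.mem_below_self _⟩

/-- The first search. -/
theorem first_search {B : ℕ} {X : Set V}
    (hX : T.runAgent B .left T.whole T.root {T.root} = X) (hne : X ≠ Set.univ) :
    T.Advance B T.whole {T.root} X ∧ ∃ pos : Dir → V, T.Searched T.whole X pos ∧
      pos .right = T.root ∧ T.depth (pos .left) ≤ B ∧
      2 + B + T.depth (pos .left) ≤ 2 * X.ncard := by
  obtain ⟨hadv, hout⟩ := runAgent_root isPart_whole ancestorClosed_root searched_whole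
    (B := B) (dir := .left) rfl ((T.depth_root).trans_le (Nat.zero_le B))
  have hroot : T.whole.root = T.root := rfl
  rw [hroot, hX] at hadv hout
  refine ⟨hadv, ?_⟩
  obtain hout | ⟨pos, c, j, hswap, hs, hB, hcount⟩ := hout
  · exact absurd (Set.univ_subset_iff.1 hout) hne
  refine ⟨pos, hs.searched, hswap, hB, ?_⟩
  -- The right position is still the root and lies below `c`, so `c` has depth 0 and `j = 0`.
  have h1 := hs.le_depth
  have h2 := depth_le_of_mem_below (hs.pos_mem_below .right)
  have h3 : pos .right = T.root := hswap
  rw [h3, depth_root] at h2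
  rw [depth_root, Set.ncard_singleton] at hcount
  lia

/-- The invariant is only available after two searches. For one agent, `D = 0` and gain 1 away from
the root suffice: by `first_search`, the weight is at least `2 * X.ncard ≥ B`. -/
theorem opt_one_le (B : ℕ) :
    T.opt 1 B ≤ 3 * (T.runAgent B .left T.whole T.root {T.root}).ncard := by
  classical
  by_cases hX : T.runAgent B .left T.whole T.root {T.root} = Set.univ
  · rw [hX]
    exact opt_le_card _ _
  obtain ⟨hadv, pos, -, -, -, hcount⟩ := first_search rfl hX
  set X := T.runAgent B .left T.whole T.root {T.root}
  have hdepth : ∀ a, T.depth a ≤ 0 → a = T.root := by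
    intro a ha
    by_contra hne
    have := depth_pos hne
    lia
  let g : V → ℝ := fun v => if v = T.root then 0 else 1
  have hg₀ : g T.root = 0 := if_pos rfl
  have hg : ∀ v, 0 ≤ g v ∧ g v ≤ 1 := fun v => by
    simp only [g]
    split_ifs <;> norm_num
  refine opt_le_of_isGain (D := 0) (g := g) ⟨fun v => (hg v).1, fun v => (hg v).2, fun v _ _ => ?_⟩
    (Nat.zero_le _) hadv.ancestorClosed (fun w _ => ⟨Nat.zero_le _, fun a _ had => ?_⟩) ?_
  · refine ⟨0, Nat.zero_le _, ?_, fun a _ had => by rw [hdepth a had, hg₀]⟩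
    have hB : (0 : ℝ) ≤ B := Nat.cast_nonneg B
    have := (hg v).2
    push_cast
    nlinarith
  · rw [hdepth a had]
    exact ⟨hadv.subset rfl, hg₀⟩
  · have h1 : (2 : ℝ) * X.ncard ≤ weight X g := by
      rw [weight, Set.ncard_eq_toFinset_card', mul_comm, ← nsmul_eq_mul]
      exact Finset.card_nsmul_le_sum _ _ _ fun v _ => by linarith [(hg v).1]
    have h2 : (2 : ℝ) + B + T.depth (pos .left) ≤ 2 * X.ncard := by exact_mod_cast hcount
    have h3 : (0 : ℝ) ≤ T.depth (pos .left) := Nat.cast_nonneg _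
    push_cast
    linarith

/-- Before any search the account has a deficit of `B`, the potential of the whole tree. Each of the
two searches from the root has a surplus of `B / 2`, and together they clear the deficit. -/
theorem invariant_start {B : ℕ} {X₁ X₂ : Set V}
    (hX₁ : T.runAgent B .left T.whole T.root {T.root} = X₁) (hne₁ : X₁ ≠ Set.univ)
    (hX₂ : T.runAgent B .right T.whole T.root X₁ = X₂) (hne₂ : X₂ ≠ Set.univ) :
    T.Invariant B 2 X₂ (T.moveDown X₂ '' {T.whole}) := by
  classical
  have hroot : T.depth T.whole.root = 0 := T.depth_root
  let i : Subtree V × (Dir → V) := (T.whole, fun _ => T.root)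
  have hforest : T.Forest B {T.root} {T.whole} {i} := by
    refine ⟨ancestorClosed_root, ?_, ?_, ?_, ?_, ?_, ?_, ?_, ?_⟩
    · rintro w rfl
      rw [depth_root]
      exact Nat.zero_le _
    · simpa [i] using isPart_whole
    · simpa [i] using searched_whole
    · simp only [Finset.mem_singleton, forall_eq]
      intro hc
      refine hne₁ (Set.univ_subset_iff.1 fun w _ => ?_)
      have hw : w = T.root := hc (Set.mem_univ w)
      rw [hw]
      exact (first_search hX₁ hne₁).1.subset rfl
    · simp
    · exact fun w _ => ⟨i, by simp, Set.mem_univ w⟩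
    · simp [i]
    · rintro S rfl -
      exact ⟨fun _ => T.root, by simp [i]⟩
  have hspread : T.spread i.1 i.2 = 0 := by
    simp [spread, i, whole]
  have hacc : ∀ D ≤ B, (∃ i' ∈ ({i} : Finset (Subtree V × (Dir → V))), T.depth i'.1.root ≤ D) →
      ∃ g, T.Account B D {T.root} {i} 0 B g := by
    intro D hD _
    refine ⟨0, ⟨fun _ => le_rfl, fun _ => zero_le_one, fun v _ hv => absurd hv (lt_irrefl _)⟩,
      fun _ _ _ _ _ => rfl, ?_⟩
    rw [Finset.sum_singleton, potential, hspread]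
    have h1 : (0 : ℝ) ≤ weight {T.root} (0 : V → ℝ) := by
      unfold weight
      exact Finset.sum_nonneg fun v _ => by simp
    have h2 : (0 : ℝ) ≤ min (T.depth i.1.root : ℝ) (D : ℝ) := by positivity
    push_cast
    linarith
  obtain ⟨hadv₁, pos, hs, hposR, hposL, hcount⟩ := first_search hX₁ hne₁
  obtain ⟨hadv₂, hout⟩ := root_search isPart_whole hadv₁.ancestorClosed hs (B := B) (dir := .right)
    hposR (by rw [hroot]; exact Nat.zero_le _) hX₂
  have hadv := hadv₁.trans hadv₂
  have hfull : ¬ T.whole.verts ⊆ X₂ := fun hc => hne₂ (Set.univ_subset_iff.1 hc)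
  obtain ⟨pos', href, hle⟩ := hout.resolve_left hfull
  have hN := outcome_singleton href hfull
  -- Both searches count as one replacement, as the account balances only after the second.
  have := hforest.invariant_replace (m := 0) (m' := 2) hacc (i := i) (by simp) (by simp) hadv
    (N := {(T.moveDown X₂ T.whole, pos')}) (G := T.moveDown X₂ '' {T.whole})
    (fun n hn => ⟨(hN.refines n hn).isPart, (hN.refines n hn).subset, (hN.refines n hn).searched,
      hN.not_subset n hn⟩) (fun n hn n' hn' hne => absurd (hN.subsingleton n hn n' hn') hne)
    (fun w hw hwX => hN.cover hw hwX) (by simp) (by simp) (by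
      rintro _ ⟨S, rfl, rfl⟩ -
      exact ⟨pos', by simp⟩) (fun D hD hDB => ?_)
  · simpa using this
  · have h1 := hle D hD hDB
    have hi : i.1 = T.whole := rfl
    rw [hi] at hD ⊢
    have h2 := root_search_inequality (n := (X₁.ncard : ℝ) - 1) (j := 0)
      (t := (T.depth (pos .left) : ℝ)) (rate_mul hD hDB) (rate_nonneg hD hDB)
      (rate_le_one hD hDB) (by rw [hroot]; push_cast; rw [sub_zero]; exact_mod_cast hposL) le_rfl (by
        have h3 : (2 : ℝ) + B + T.depth (pos .left) ≤ 2 * X₁.ncard := by exact_mod_cast hcount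
        rw [hroot]
        push_cast
        linarith)
    rw [hi] at hspread
    have hswap : Dir.right.swap = Dir.left := rfl
    rw [Finset.sum_singleton, Set.ncard_singleton]
    rw [hswap] at h1
    have hspread' : T.spread T.whole i.2 = 0 := hspread
    rw [hspread']
    simp only [hroot, Nat.cast_zero, sub_zero, Nat.cast_one, Nat.cast_ofNat] at h1 h2 ⊢
    linarith

theorem opt_zero (B : ℕ) : T.opt 0 B = 0 := by
  obtain ⟨e, W, -, hcard⟩ := (T.isGreatest_opt 0 B).1
  rw [← hcard]
  simp

end PortTree

theorem mainTheorem1 {V : Type*} [Fintype V] (T : PortTree V) (k B : ℕ)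
    (tie : ℕ → Set (Subtree V) → Subtree V)
    (htie : ∀ (n : ℕ) (A : Set (Subtree V)), A.Nonempty → tie n A ∈ A) :
    T.opt k B ≤ 3 * (T.divideAndExplore B tie k).ncard := by
  match k with
  | 0 =>
    rw [PortTree.opt_zero]
    exact Nat.zero_le _
  | 1 => exact PortTree.opt_one_le B
  | k + 2 =>
    rw [PortTree.divideAndExplore]
    set X₁ := T.runAgent B .left T.whole T.root {T.root} with hX₁
    set X₂ := T.runAgent B .right T.whole T.root X₁ with hX₂
    by_cases hne₂ : X₂ = Set.univ
    · rw [hne₂, PortTree.exploreLoop_univ]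
      exact PortTree.opt_le_card _ _
    have hne₁ : X₁ ≠ Set.univ := by
      intro h
      refine hne₂ ?_
      rw [hX₂, h, PortTree.runAgent, Set.univ_union, PortTree.dfsLoop_univ]
    rw [Nat.add_comm k 2]
    exact PortTree.opt_le_exploreLoop htie k 2 X₂ _
      (PortTree.invariant_start hX₁.symm hne₁ hX₂.symm hne₂)
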